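/- Let $G$ be a locally finite weakly connected digraph (parallel edges allowed, no loops), i.e. every vertex is incident with only finitely many edges and the underlying undirected multigraph is connected. Let $\Omega(G)$ be the set of ends of its underlying multigraph, i.e. the equivalence classes of rays (one-way infinite paths), two rays being equivalent if they cannot be separated by finitely many vertices, and let $|G|$ be the Freudenthal compactification of the underlying multigraph viewed as a $1$-complex, whose points are the vertices, the ends and the inner points of edges. For $X \subseteq V(G)$ let $\overline{X}$ consist of $X$ together with all ends that contain a ray which cannot be separated from $X$ by finitely many vertices, and for $A \subseteq E(G)$ let $\overline{A}$ be the topological closure in $|G|$ of the union of the edges in $A$. For a bipartition $(X,Y)$ of $V(G)$ let $\overrightarrow{E}(X,Y)$ be the set of edges with tail in $X$ and head in $Y$, and let $E(X,Y) = \overrightarrow{E}(X,Y) \cup \overrightarrow{E}(Y,X)$ be the corresponding cut. A directed $s$–$t$ arc is the image of a homeomorphism $\sigma$ from $[0,1]$ onto a subspace of $|G|$ with $\sigma(0)=s$ and $\sigma(1)=t$ that traverses the inner points of every edge it meets in the direction of that edge, from its tail towards its head. Let $s,t \in V(G) \cup \Omega(G)$ with $s \neq t$, and let $A \subseteq E(G)$.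 Then the following statements are equivalent: (i) $\overline{A}$ is a directed $s$–$t$ arc. (ii) $A$ is inclusion-wise minimal such that $|A \cap \overrightarrow{E}(X,Y)| \geq 1$ holds for every finite cut $E(X,Y)$ of $G$ with $s \in \overline{X}$ and $t \in \overline{Y}$. (iii) $A$ is inclusion-wise minimal such that $|A \cap \overrightarrow{E}(X,Y)| = |A \cap \overrightarrow{E}(Y,X)| + 1$ holds for every finite cut $E(X,Y)$ of $G$ with $s \in \overline{X}$ and $t \in \overline{Y}$. -/

import Mathlib

open Topology

/-- A digraph with vertex set `V` and edge set `E`: parallel edges (in either direction) are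
allowed, loops are not. The edge `e` is directed from `tail e` to `head e`. -/
structure DirMultigraph (V : Type*) (E : Type*) where
  tail : E → V
  head : E → V
  loopless : ∀ e, tail e ≠ head e

namespace DirMultigraph

universe u v

section Basic

variable {V : Type u} {E : Type v} (G : DirMultigraph V E)

/-- `e` joins `a` and `b` in the underlying undirected multigraph. -/
def Joins (e : E) (a b : V) : Prop :=
  (G.tail e = a ∧ G.head e = b) ∨ (G.tail e = b ∧ G.head e = a)

/-- Adjacency in the underlying undirected multigraph. -/
def adjGraph : SimpleGraph V where
  Adj a b := ∃ e, G.Joins e a b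
  symm := ⟨fun _ _ ⟨e, he⟩ => ⟨e, he.symm⟩⟩
  loopless := ⟨fun _ ⟨e, he⟩ => by
    rcases he with h | h <;> exact G.loopless e (h.1.trans h.2.symm)⟩

/-- Every vertex is incident with only finitely many edges. -/
def LocallyFinite : Prop := ∀ a : V, {e : E | G.tail e = a ∨ G.head e = a}.Finite

/-- The underlying undirected multigraph is connected. -/
def WeaklyConnected : Prop := G.adjGraph.Connected

/-- The edges with tail in `X` and head in `Y`. -/
def dirEdges (X Y : Set V) : Set E := {e | G.tail e ∈ X ∧ G.head e ∈ Y}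

/-- The edges between `X` and `Y` in either direction. -/
def edgesBetween (X Y : Set V) : Set E := G.dirEdges X Y ∪ G.dirEdges Y X

/-- `(X, Y)` is a bipartition of the vertex set and the cut consisting of the edges between
`X` and `Y` is finite. -/
def IsFiniteCut (X Y : Set V) : Prop := IsCompl X Y ∧ (G.edgesBetween X Y).Finite

/-- `a` and `b` are joined by a walk (equivalently, a path) all of whose vertices lie outside
`S`: they lie in the same component of the underlying multigraph minus `S`. -/
def ConnAvoiding (S : Set V) (a b : V) : Prop :=
  ∃ p : G.adjGraph.Walk a b, ∀ w ∈ p.support, w ∉ S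

/-- A ray (one-way infinite path) `vert 0, edge 0, vert 1, edge 1, …` of the underlying
undirected multigraph. -/
structure Ray where
  vert : ℕ → V
  edge : ℕ → E
  joins : ∀ n, G.Joins (edge n) (vert n) (vert (n + 1))
  inj : Function.Injective vert

variable {G}

theorem ConnAvoiding.symm {S : Set V} {a b : V} (h : G.ConnAvoiding S a b) :
    G.ConnAvoiding S b a := by
  obtain ⟨p, hp⟩ := h
  exact ⟨p.reverse, fun w hw => hp w (by simpa using hw)⟩

theorem ConnAvoiding.trans {S : Set V} {a b c : V} (h : G.ConnAvoiding S a b)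
    (h' : G.ConnAvoiding S b c) : G.ConnAvoiding S a c := by
  obtain ⟨p, hp⟩ := h
  obtain ⟨q, hq⟩ := h'
  refine ⟨p.append q, fun w hw => ?_⟩
  rcases (SimpleGraph.Walk.mem_support_append_iff p q).1 hw with h | h
  exacts [hp w h, hq w h]

theorem ConnAvoiding.mono {S T : Set V} (hST : S ⊆ T) {a b : V} (h : G.ConnAvoiding T a b) :
    G.ConnAvoiding S a b := by
  obtain ⟨p, hp⟩ := h
  exact ⟨p, fun w hw hS => hp w hw (hST hS)⟩

theorem ConnAvoiding.notMem_left {S : Set V} {a b : V} (h : G.ConnAvoiding S a b) : a ∉ S := by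
  obtain ⟨p, hp⟩ := h
  exact hp a p.start_mem_support

theorem Ray.exists_tail_avoiding (R : G.Ray) {S : Set V} (hS : S.Finite) :
    ∃ N, ∀ n, N ≤ n → R.vert n ∉ S := by
  have hfin : (R.vert ⁻¹' S).Finite := hS.preimage R.inj.injOn
  obtain ⟨N, hN⟩ := hfin.bddAbove
  exact ⟨N + 1, fun n hn hmem => by have := hN (Set.mem_preimage.2 hmem); omega⟩

theorem Ray.connAvoiding_tail (R : G.Ray) {S : Set V} {N : ℕ}
    (hN : ∀ n, N ≤ n → R.vert n ∉ S) {m : ℕ} (hm : N ≤ m) :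
    G.ConnAvoiding S (R.vert N) (R.vert m) := by
  induction m, hm using Nat.le_induction with
  | base => exact ⟨SimpleGraph.Walk.nil, by simpa using hN N le_rfl⟩
  | succ m hm ih =>
    have hadj : G.adjGraph.Adj (R.vert m) (R.vert (m + 1)) := ⟨R.edge m, R.joins m⟩
    refine ih.trans ⟨hadj.toWalk, ?_⟩
    have h1 := hN m hm
    have h2 := hN (m + 1) (by omega)
    simp only [SimpleGraph.Walk.support_cons, SimpleGraph.Walk.support_nil, List.mem_cons,
      List.not_mem_nil, or_false]
    rintro w (rfl | rfl)
    exacts [h1, h2]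

variable (G)

/-- Two rays are equivalent if they cannot be separated by finitely many vertices. -/
def rayEquiv (R R' : G.Ray) : Prop :=
  ∀ S : Set V, S.Finite → ∃ m n, G.ConnAvoiding S (R.vert m) (R'.vert n)

theorem rayEquiv_equivalence : Equivalence G.rayEquiv where
  refl R S hS := by
    obtain ⟨N, hN⟩ := R.exists_tail_avoiding hS
    exact ⟨N, N, R.connAvoiding_tail hN le_rfl⟩
  symm h S hS := by
    obtain ⟨m, n, hmn⟩ := h S hS
    exact ⟨n, m, hmn.symm⟩
  trans := by
    intro R₁ R₂ R₃ h12 h23 S hS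
    obtain ⟨N, hN⟩ := R₂.exists_tail_avoiding hS
    have hT : (S ∪ R₂.vert '' Set.Iio N).Finite := hS.union ((Set.finite_Iio N).image _)
    obtain ⟨i, m, him⟩ := h12 _ hT
    obtain ⟨m', k, hmk⟩ := h23 _ hT
    have hm : N ≤ m := by
      by_contra hlt
      exact him.symm.notMem_left (Or.inr ⟨m, by simpa using hlt, rfl⟩)
    have hm' : N ≤ m' := by
      by_contra hlt
      exact hmk.notMem_left (Or.inr ⟨m', by simpa using hlt, rfl⟩)
    refine ⟨i, k, ?_⟩
    exact (him.mono Set.subset_union_left).trans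
      (((R₂.connAvoiding_tail hN hm).symm.trans (R₂.connAvoiding_tail hN hm')).trans
        (hmk.mono Set.subset_union_left))

def raySetoid : Setoid G.Ray := ⟨G.rayEquiv, G.rayEquiv_equivalence⟩

/-- The ends of `G`: the equivalence classes of rays of the underlying undirected multigraph. -/
def Ends : Type (max u v) := Quotient G.raySetoid

/-- The end containing a given ray. -/
def Ray.toEnd {G : DirMultigraph V E} (R : G.Ray) : G.Ends := Quotient.mk G.raySetoid R

/-- The point set of `|G|`: the vertices, the ends, and the inner points of the edges.
Each edge is a copy of the interval `[0, 1]`, where `0` is its tail and `1` is its head. -/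
inductive Point : Type (max u v)
  | vertex (a : V) : Point
  | ofEnd (ω : G.Ends) : Point
  | inner (e : E) (x : Set.Ioo (0 : ℝ) 1) : Point

/-- The vertex set of the component `C(S, ω)` of `G - S` in which the end `ω` lives, i.e. which
contains a tail of some (equivalently, every) ray in `ω`. -/
def endComponent (S : Set V) (ω : G.Ends) : Set V :=
  {a | ∃ R : G.Ray, R.toEnd = ω ∧ ∃ N, (∀ n, N ≤ n → R.vert n ∉ S) ∧
    G.ConnAvoiding S (R.vert N) a}

/-- The basic neighbourhood of the end `ω` given by the finite vertex set `S`: all vertices of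
`C(S, ω)`, all ends living in `C(S, ω)`, and all inner points of edges with at least one
endvertex in `C(S, ω)`. -/
def endNhd (S : Set V) (ω : G.Ends) : Set G.Point :=
  {p | match p with
    | .vertex a => a ∈ G.endComponent S ω
    | .ofEnd ω' => ∃ R : G.Ray, R.toEnd = ω' ∧ ∃ N, ∀ n, N ≤ n →
        R.vert n ∈ G.endComponent S ω
    | .inner e _ => G.tail e ∈ G.endComponent S ω ∨ G.head e ∈ G.endComponent S ω}

theorem endComponent_anti {S T : Set V} (hST : S ⊆ T) (ω : G.Ends) :
    G.endComponent T ω ⊆ G.endComponent S ω := by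
  rintro a ⟨R, hR, N, hN, hc⟩
  exact ⟨R, hR, N, fun n hn h => hN n hn (hST h), hc.mono hST⟩

theorem endNhd_anti {S T : Set V} (hST : S ⊆ T) (ω : G.Ends) :
    G.endNhd T ω ⊆ G.endNhd S ω := by
  have h := G.endComponent_anti hST ω
  rintro (a | ω' | ⟨e, x⟩) hp
  · exact h hp
  · obtain ⟨R, hR, N, hN⟩ := hp
    exact ⟨R, hR, N, fun n hn => h (hN n hn)⟩
  · exact hp.imp (fun k => h k) (fun k => h k)

/-- A set `U` of points is open if with every point it contains a basic neighbourhood of it: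
for an inner point of an edge, an open interval of that edge around it; for a vertex, a
half-open initial interval of each edge at that vertex; for an end `ω`, a set `endNhd S ω` with
`S` finite. -/
def IsOpenSet (U : Set G.Point) : Prop :=
  (∀ e x, Point.inner e x ∈ U →
    ∃ ε > 0, ∀ y : Set.Ioo (0 : ℝ) 1, |(y : ℝ) - x| < ε → Point.inner e y ∈ U) ∧
  (∀ a, Point.vertex a ∈ U →
    (∀ e, G.tail e = a → ∃ ε > 0, ∀ y : Set.Ioo (0 : ℝ) 1, (y : ℝ) < ε → Point.inner e y ∈ U) ∧
    (∀ e, G.head e = a →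
      ∃ ε > 0, ∀ y : Set.Ioo (0 : ℝ) 1, 1 - ε < (y : ℝ) → Point.inner e y ∈ U)) ∧
  (∀ ω, Point.ofEnd ω ∈ U → ∃ S : Set V, S.Finite ∧ G.endNhd S ω ⊆ U)

/-- The topological space `|G|`: for a locally finite connected underlying multigraph this is
its Freudenthal compactification. -/
instance : TopologicalSpace G.Point where
  IsOpen := G.IsOpenSet
  isOpen_univ := ⟨fun _ _ _ => ⟨1, one_pos, fun _ _ => trivial⟩,
    fun _ _ => ⟨fun _ _ => ⟨1, one_pos, fun _ _ => trivial⟩,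
      fun _ _ => ⟨1, one_pos, fun _ _ => trivial⟩⟩,
    fun _ _ => ⟨∅, Set.finite_empty, fun _ _ => trivial⟩⟩
  isOpen_inter := by
    rintro U U' ⟨hi, hv, he⟩ ⟨hi', hv', he'⟩
    refine ⟨fun e x hx => ?_, fun a ha => ⟨fun e h => ?_, fun e h => ?_⟩, fun ω hω => ?_⟩
    · obtain ⟨ε, hε, h1⟩ := hi e x hx.1
      obtain ⟨ε', hε', h2⟩ := hi' e x hx.2
      exact ⟨min ε ε', lt_min hε hε', fun y hy =>
        ⟨h1 y (hy.trans_le (min_le_left _ _)), h2 y (hy.trans_le (min_le_right _ _))⟩⟩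
    · obtain ⟨ε, hε, h1⟩ := (hv a ha.1).1 e h
      obtain ⟨ε', hε', h2⟩ := (hv' a ha.2).1 e h
      exact ⟨min ε ε', lt_min hε hε', fun y hy =>
        ⟨h1 y (hy.trans_le (min_le_left _ _)), h2 y (hy.trans_le (min_le_right _ _))⟩⟩
    · obtain ⟨ε, hε, h1⟩ := (hv a ha.1).2 e h
      obtain ⟨ε', hε', h2⟩ := (hv' a ha.2).2 e h
      refine ⟨min ε ε', lt_min hε hε', fun y hy => ⟨h1 y ?_, h2 y ?_⟩⟩
      · linarith [min_le_left ε ε']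
      · linarith [min_le_right ε ε']
    · obtain ⟨S, hS, h1⟩ := he ω hω.1
      obtain ⟨S', hS', h2⟩ := he' ω hω.2
      exact ⟨S ∪ S', hS.union hS', fun p hp =>
        ⟨h1 (G.endNhd_anti Set.subset_union_left ω hp),
          h2 (G.endNhd_anti Set.subset_union_right ω hp)⟩⟩
  isOpen_sUnion := by
    intro 𝒰 h𝒰
    refine ⟨fun e x hx => ?_, fun a ha => ⟨fun e h => ?_, fun e h => ?_⟩, fun ω hω => ?_⟩
    · obtain ⟨U, hU, hx⟩ := hx
      obtain ⟨ε, hε, h1⟩ := (h𝒰 U hU).1 e x hx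
      exact ⟨ε, hε, fun y hy => ⟨U, hU, h1 y hy⟩⟩
    · obtain ⟨U, hU, ha⟩ := ha
      obtain ⟨ε, hε, h1⟩ := ((h𝒰 U hU).2.1 a ha).1 e h
      exact ⟨ε, hε, fun y hy => ⟨U, hU, h1 y hy⟩⟩
    · obtain ⟨U, hU, ha⟩ := ha
      obtain ⟨ε, hε, h1⟩ := ((h𝒰 U hU).2.1 a ha).2 e h
      exact ⟨ε, hε, fun y hy => ⟨U, hU, h1 y hy⟩⟩
    · obtain ⟨U, hU, hω⟩ := hω
      obtain ⟨S, hS, h1⟩ := (h𝒰 U hU).2.2 ω hω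
      exact ⟨S, hS, fun p hp => ⟨U, hU, h1 hp⟩⟩

/-- The set of all vertices and ends, as a set of points of `|G|`. -/
def verticesAndEnds : Set G.Point :=
  Set.range (Point.vertex : V → G.Point) ∪ Set.range Point.ofEnd

/-- The combinatorial closure of a vertex set `X`: the vertices in `X` together with all ends
that contain a ray which cannot be separated from `X` by finitely many vertices. -/
def combClosure (X : Set V) : Set G.Point :=
  {p | match p with
    | .vertex a => a ∈ X
    | .ofEnd ω => ∃ R : G.Ray, R.toEnd = ω ∧
        ∀ S : Set V, S.Finite → ∃ n, ∃ a ∈ X, G.ConnAvoiding S (R.vert n) a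
    | .inner _ _ => False}

/-- All points of `|G|` on the edges in `A`, including their endvertices. -/
def edgePoints (A : Set E) : Set G.Point :=
  {p | match p with
    | .vertex a => ∃ e ∈ A, G.tail e = a ∨ G.head e = a
    | .ofEnd _ => False
    | .inner e _ => e ∈ A}

/-- The closure in `|G|` of the edge set `A`. -/
def edgeClosure (A : Set E) : Set G.Point := closure (G.edgePoints A)

variable {G}

/-- For an injective `σ`, the order in which `σ` traverses the points of its image:
`p` comes before `q`. -/
def traversalLT (σ : unitInterval → G.Point) (p q : G.Point) : Prop :=
  ∃ x y, σ x = p ∧ σ y = q ∧ x < y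

variable (G)

/-- `W` is a directed `s`–`t` arc: it is the image of a homeomorphism `σ` from `[0, 1]` onto a
subspace of `|G|` that starts in `s`, ends in `t` and traverses the inner points of each edge it
meets in the order given by the direction of that edge, from tail to head. -/
def IsDirectedArc (s t : G.Point) (W : Set G.Point) : Prop :=
  ∃ σ : unitInterval → G.Point, IsEmbedding σ ∧ Set.range σ = W ∧ σ 0 = s ∧ σ 1 = t ∧
    ∀ (e : E) (x y : Set.Ioo (0 : ℝ) 1), Point.inner e x ∈ W → Point.inner e y ∈ W →
      (traversalLT σ (Point.inner e x) (Point.inner e y) ↔ x < y)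

/-- `A` contains an edge directed from `X` to `Y` for every finite cut `E(X, Y)` with
`s` in the closure of `X` and `t` in the closure of `Y`. -/
def MeetsCuts (s t : G.Point) (A : Set E) : Prop :=
  ∀ X Y : Set V, G.IsFiniteCut X Y → s ∈ G.combClosure X → t ∈ G.combClosure Y →
    1 ≤ (A ∩ G.dirEdges X Y).encard

/-- For every finite cut `E(X, Y)` with `s` in the closure of `X` and `t` in the closure of `Y`,
`A` contains exactly one more edge directed from `X` to `Y` than from `Y` to `X`. -/
def BalancedOnCuts (s t : G.Point) (A : Set E) : Prop :=
  ∀ X Y : Set V, G.IsFiniteCut X Y → s ∈ G.combClosure X → t ∈ G.combClosure Y →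
    (A ∩ G.dirEdges X Y).encard = (A ∩ G.dirEdges Y X).encard + 1

end Basic

end DirMultigraph

/-! Everything is reduced to finite cuts. On a set `X` with finite boundary, an end lies in the
closure of `X` exactly when its rays eventually stay in `X`. "The side of a point" is thus
membership in an ultrafilter (`nearby`), and sides respect unions, intersections and complements.
`cutFun X` extends the cut to a continuous function on the whole space.

From (ii) to (i): by minimality every `e ∈ A` has a cut `X e` that only `e` leaves among the edges
of `A`, and uncrossing shows that no edge of `A` enters `X e` (`exists_isTightFamily`). These tight
cuts order `A` linearly: `e` precedes `f` when `G.tail e ∈ X f`. With positive weights of total 1,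
the map `position`, the weighted sum of the `cutFun (X e)`, is continuous. It is injective on the
closure of `A` because uncrossing shows that tight cuts separate its vertices and ends. It is onto
`[0, 1]` because a gap would cost total weight. By compactness it is a homeomorphism, and its
inverse is the arc.

From (i) to (ii): the last moment at which `cutFun X` is at most 1/2 lies inside an edge leaving
`X`. If a subset of `A` also met all cuts, it would contain a minimal one, whose closure is an arc
inside the given arc with the same endpoints, hence all of it.

For (iii): net outflow is modular, so uncrossing with tight cuts forces it to be 1 on every
separating cut (`balancedOnCuts_of_minimal`). Conversely a balanced set meets all cuts, and a
minimal subset meeting all cuts is itself balanced. -/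

namespace DirMultigraph

/-! ### Finite cuts, the sides of ends, and continuous cut functions -/

section Cuts

open Filter

variable {V E : Type*} {G : DirMultigraph V E}

/-- Only finitely many edges join `X` to its complement. -/
def FiniteBoundary (G : DirMultigraph V E) (X : Set V) : Prop :=
  (G.edgesBetween X Xᶜ).Finite

theorem mem_edgesBetween_compl {X : Set V} {e : E} :
    e ∈ G.edgesBetween X Xᶜ ↔ ¬(G.tail e ∈ X ↔ G.head e ∈ X) := by
  simp only [edgesBetween, dirEdges, Set.mem_union, Set.mem_ofPred_eq, Set.mem_compl_iff]
  tauto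

theorem FiniteBoundary.compl {X : Set V} (h : G.FiniteBoundary X) : G.FiniteBoundary Xᶜ := by
  refine Set.Finite.subset h fun e he => ?_
  rw [mem_edgesBetween_compl] at he ⊢
  simp only [Set.mem_compl_iff] at he
  tauto

theorem FiniteBoundary.inter {X Y : Set V} (hX : G.FiniteBoundary X) (hY : G.FiniteBoundary Y) :
    G.FiniteBoundary (X ∩ Y) := by
  refine Set.Finite.subset (hX.union hY) fun e he => ?_
  rw [Set.mem_union]
  rw [mem_edgesBetween_compl] at he ⊢
  rw [mem_edgesBetween_compl]
  simp only [Set.mem_inter_iff] at he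
  tauto

theorem FiniteBoundary.union {X Y : Set V} (hX : G.FiniteBoundary X) (hY : G.FiniteBoundary Y) :
    G.FiniteBoundary (X ∪ Y) := by
  have := (hX.compl.inter hY.compl).compl
  rwa [← Set.compl_union, compl_compl] at this

/-- The endvertices of the edges joining `X` to its complement. -/
def boundaryVertices (G : DirMultigraph V E) (X : Set V) : Set V :=
  G.tail '' G.edgesBetween X Xᶜ ∪ G.head '' G.edgesBetween X Xᶜ

theorem FiniteBoundary.finite_boundaryVertices {X : Set V} (h : G.FiniteBoundary X) :
    (G.boundaryVertices X).Finite :=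
  (h.image _).union (h.image _)

theorem tail_mem_iff_head_mem {X : Set V} {e : E}
    (h : G.tail e ∉ G.boundaryVertices X ∨ G.head e ∉ G.boundaryVertices X) :
    G.tail e ∈ X ↔ G.head e ∈ X := by
  by_contra hne
  have he : e ∈ G.edgesBetween X Xᶜ := mem_edgesBetween_compl.2 hne
  exact h.elim (fun k => k (Or.inl ⟨e, he, rfl⟩)) (fun k => k (Or.inr ⟨e, he, rfl⟩))

/-- A walk can change sides only along a boundary edge, whose endvertices it avoids. -/
theorem ConnAvoiding.mem_iff {X S : Set V} (hS : G.boundaryVertices X ⊆ S) {a b : V}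
    (h : G.ConnAvoiding S a b) : a ∈ X ↔ b ∈ X := by
  obtain ⟨p, hp⟩ := h
  induction p with
  | nil => rfl
  | @cons u v w huv p ih =>
    rw [← ih fun x hx => hp x (by simp [hx])]
    have hu : u ∉ G.boundaryVertices X := fun h => hp u (by simp) (hS h)
    have hv : v ∉ G.boundaryVertices X := fun h => hp v (by simp) (hS h)
    obtain ⟨e, ⟨rfl, rfl⟩ | ⟨rfl, rfl⟩⟩ := huv
    · exact tail_mem_iff_head_mem (Or.inl hu)
    · exact (tail_mem_iff_head_mem (Or.inl hv)).symm

/-- An ultrafilter of vertices approaching the given point: the principal one at a vertex (or at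
the tail of an edge), and one along a ray converging to an end. -/
noncomputable def nearby : G.Point → Ultrafilter V
  | .vertex a => pure a
  | .ofEnd ω => (hyperfilter ℕ).map (Quotient.out ω : G.Ray).vert
  | .inner e _ => pure (G.tail e)

theorem eventually_mem_or_eventually_notMem {X : Set V} (hX : G.FiniteBoundary X) (R : G.Ray) :
    (∀ᶠ n in atTop, R.vert n ∈ X) ∨ ∀ᶠ n in atTop, R.vert n ∉ X := by
  obtain ⟨N, hN⟩ := R.exists_tail_avoiding hX.finite_boundaryVertices
  have h : ∀ m, N ≤ m → (R.vert N ∈ X ↔ R.vert m ∈ X) := fun m hm =>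
    (R.connAvoiding_tail hN hm).mem_iff subset_rfl
  by_cases hmem : R.vert N ∈ X
  · exact Or.inl (eventually_atTop.2 ⟨N, fun m hm => (h m hm).1 hmem⟩)
  · exact Or.inr (eventually_atTop.2 ⟨N, fun m hm k => hmem ((h m hm).2 k)⟩)

theorem eventually_mem_of_rayEquiv {X : Set V} (hX : G.FiniteBoundary X) {R R' : G.Ray}
    (h : G.rayEquiv R R') (hR : ∀ᶠ n in atTop, R.vert n ∈ X) :
    ∀ᶠ n in atTop, R'.vert n ∈ X := by
  refine (eventually_mem_or_eventually_notMem hX R').resolve_right fun hR' => ?_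
  obtain ⟨N, hN⟩ := eventually_atTop.1 hR
  obtain ⟨N', hN'⟩ := eventually_atTop.1 hR'
  -- Deleting the initial segments as well forces the connecting walk to join the tails of the two
  -- rays, where the sides are known.
  obtain ⟨m, n, hmn⟩ := h (G.boundaryVertices X ∪ (R.vert '' Set.Iio N ∪ R'.vert '' Set.Iio N'))
    (hX.finite_boundaryVertices.union
      (((Set.finite_Iio N).image _).union ((Set.finite_Iio N').image _)))
  have hm : N ≤ m := by
    by_contra hlt
    exact hmn.notMem_left (Or.inr (Or.inl ⟨m, by simpa using hlt, rfl⟩))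
  have hn : N' ≤ n := by
    by_contra hlt
    exact hmn.symm.notMem_left (Or.inr (Or.inr ⟨n, by simpa using hlt, rfl⟩))
  exact hN' n hn ((hmn.mem_iff Set.subset_union_left).1 (hN m hm))

theorem toEnd_mem_combClosure {X : Set V} (hX : G.FiniteBoundary X) (R : G.Ray) :
    Point.ofEnd R.toEnd ∈ G.combClosure X ↔ ∀ᶠ n in atTop, R.vert n ∈ X := by
  constructor
  · rintro ⟨R', hR', h⟩
    refine eventually_mem_of_rayEquiv hX (Quotient.exact hR') ?_
    refine (eventually_mem_or_eventually_notMem hX R').resolve_right fun hn => ?_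
    obtain ⟨N, hN⟩ := eventually_atTop.1 hn
    obtain ⟨n, a, ha, hna⟩ := h (G.boundaryVertices X ∪ R'.vert '' Set.Iio N)
      (hX.finite_boundaryVertices.union ((Set.finite_Iio N).image _))
    have hm : N ≤ n := by
      by_contra hlt
      exact hna.notMem_left (Or.inr ⟨n, by simpa using hlt, rfl⟩)
    exact hN n hm ((hna.mem_iff Set.subset_union_left).2 ha)
  · intro h
    obtain ⟨N, hN⟩ := eventually_atTop.1 h
    refine ⟨R, rfl, fun S hS => ?_⟩
    obtain ⟨M, hM⟩ := R.exists_tail_avoiding hS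
    exact ⟨max M N, R.vert (max M N), hN _ (le_max_right _ _),
      SimpleGraph.Walk.nil, by simpa using hM _ (le_max_left _ _)⟩

/-- The finite boundary makes every ray settle on one side, so the chosen representative ray and the
chosen hyperfilter do not matter. From here on, closures are handled by ultrafilter rules. -/
theorem mem_combClosure_iff {X : Set V} (hX : G.FiniteBoundary X) {p : G.Point}
    (hp : p ∈ G.verticesAndEnds) : p ∈ G.combClosure X ↔ X ∈ nearby p := by
  rcases hp with ⟨a, rfl⟩ | ⟨ω, rfl⟩
  · exact Iff.rfl
  · obtain ⟨R, rfl, hR⟩ : ∃ R : G.Ray, R.toEnd = ω ∧ R = Quotient.out ω :=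
      ⟨Quotient.out ω, Quotient.out_eq ω, rfl⟩
    rw [toEnd_mem_combClosure hX]
    change _ ↔ _ ∈ (hyperfilter ℕ).map (Quotient.out R.toEnd : G.Ray).vert
    rw [← hR, Ultrafilter.mem_map]
    constructor
    · exact fun h => Nat.hyperfilter_le_atTop h
    · intro h
      refine (eventually_mem_or_eventually_notMem hX R).resolve_right fun hn => ?_
      exact Ultrafilter.compl_notMem_iff.2 h (Nat.hyperfilter_le_atTop hn)

theorem LocallyFinite.finiteBoundary_of_boundary_subset (hlf : G.LocallyFinite) {X S : Set V}
    (hS : S.Finite) (h : ∀ e, ¬(G.tail e ∈ X ↔ G.head e ∈ X) → G.tail e ∈ S ∨ G.head e ∈ S) :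
    G.FiniteBoundary X := by
  refine Set.Finite.subset (hS.biUnion fun a _ => hlf a) fun e he => ?_
  rw [mem_edgesBetween_compl] at he
  simp only [Set.mem_iUnion, Set.mem_ofPred_eq]
  rcases h e he with h | h
  exacts [⟨_, h, Or.inl rfl⟩, ⟨_, h, Or.inr rfl⟩]

theorem LocallyFinite.exists_separating (hlf : G.LocallyFinite) {p q : G.Point}
    (hp : p ∈ G.verticesAndEnds) (hq : q ∈ G.verticesAndEnds) (hpq : p ≠ q) :
    ∃ X, G.FiniteBoundary X ∧ X ∈ nearby p ∧ X ∉ nearby q := by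
  have hsing : ∀ a, G.FiniteBoundary {a} := fun a =>
    hlf.finiteBoundary_of_boundary_subset (Set.finite_singleton a) fun e he => by
      simp only [Set.mem_singleton_iff] at he ⊢
      tauto
  have hvert : ∀ (a : V) {p : G.Point}, p ∈ G.verticesAndEnds → p ≠ .vertex a →
      {a} ∉ nearby p := by
    rintro a _ (⟨b, rfl⟩ | ⟨ω, rfl⟩) hne
    · rintro rfl
      exact hne rfl
    · intro h
      rw [← mem_combClosure_iff (hsing a) (Or.inr ⟨ω, rfl⟩)] at h
      obtain ⟨R, rfl⟩ := Quotient.exists_rep ω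
      obtain ⟨N, hN⟩ := eventually_atTop.1 ((toEnd_mem_combClosure (hsing a) R).1 h)
      have := R.inj ((hN N le_rfl).trans (hN (N + 1) (by omega)).symm)
      omega
  rcases hp with ⟨a, rfl⟩ | ⟨ω, rfl⟩
  · exact ⟨{a}, hsing a, rfl, hvert a hq hpq.symm⟩
  rcases hq with ⟨b, rfl⟩ | ⟨ω', rfl⟩
  · exact ⟨{b}ᶜ, (hsing b).compl, Ultrafilter.compl_mem_iff_notMem.2
      (hvert b (Or.inr ⟨ω, rfl⟩) hpq), fun h => h rfl⟩
  obtain ⟨R, rfl⟩ := Quotient.exists_rep ω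
  obtain ⟨R', rfl⟩ := Quotient.exists_rep ω'
  have hne : ¬G.rayEquiv R R' := fun h => hpq (congrArg Point.ofEnd (Quotient.sound h))
  unfold rayEquiv at hne
  push Not at hne
  obtain ⟨S, hS, hsep⟩ := hne
  -- The separating set consists of all vertices reachable from `R` outside `S`; an edge of its
  -- boundary must have an endvertex in `S`.
  have hX : G.FiniteBoundary {a | ∃ m, G.ConnAvoiding S (R.vert m) a} := by
    refine hlf.finiteBoundary_of_boundary_subset hS fun e he => ?_
    by_contra hnot
    push Not at hnot
    have hc : G.ConnAvoiding S (G.tail e) (G.head e) := by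
      have hadj : G.adjGraph.Adj (G.tail e) (G.head e) := ⟨e, Or.inl ⟨rfl, rfl⟩⟩
      refine ⟨hadj.toWalk, ?_⟩
      simp only [SimpleGraph.Walk.support_cons, SimpleGraph.Walk.support_nil, List.mem_cons,
        List.not_mem_nil, or_false]
      rintro w (rfl | rfl)
      exacts [hnot.1, hnot.2]
    exact he ⟨fun ⟨m, hm⟩ => ⟨m, hm.trans hc⟩, fun ⟨m, hm⟩ => ⟨m, hm.trans hc.symm⟩⟩
  refine ⟨_, hX, (mem_combClosure_iff hX (Or.inr ⟨_, rfl⟩)).1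
    ((toEnd_mem_combClosure hX R).2 ?_), fun h => ?_⟩
  · obtain ⟨N, hN⟩ := R.exists_tail_avoiding hS
    exact eventually_atTop.2 ⟨N, fun m hm => ⟨N, R.connAvoiding_tail hN hm⟩⟩
  · have h' := (mem_combClosure_iff hX (Or.inr ⟨_, rfl⟩)).2 h
    obtain ⟨N, hN⟩ := eventually_atTop.1 ((toEnd_mem_combClosure hX R').1 h')
    obtain ⟨m, hm⟩ := hN N le_rfl
    exact hsep m N hm

open Classical in
/-- The function on `|G|` that is `0` on `X`, `1` on the complement of `X`, and linear on every
edge. -/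
noncomputable def cutFun (X : Set V) : G.Point → ℝ
  | .inner e x => (1 - x) * (if G.tail e ∈ X then 0 else 1) + x * (if G.head e ∈ X then 0 else 1)
  | .vertex a => if a ∈ X then 0 else 1
  | .ofEnd ω => if X ∈ nearby (.ofEnd ω : G.Point) then 0 else 1

open Classical in
theorem cutFun_eq_ite (X : Set V) {p : G.Point} (hp : p ∈ G.verticesAndEnds) :
    cutFun X p = if X ∈ nearby p then 0 else 1 := by
  rcases hp with ⟨a, rfl⟩ | ⟨ω, rfl⟩ <;> rfl

theorem cutFun_eq_zero {X : Set V} {p : G.Point} (hp : p ∈ G.verticesAndEnds)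
    (h : X ∈ nearby p) : cutFun X p = 0 := by
  rw [cutFun_eq_ite X hp, if_pos h]

theorem cutFun_eq_one {X : Set V} {p : G.Point} (hp : p ∈ G.verticesAndEnds)
    (h : X ∉ nearby p) : cutFun X p = 1 := by
  rw [cutFun_eq_ite X hp, if_neg h]

theorem cutFun_mem_Icc (X : Set V) (p : G.Point) : cutFun X p ∈ Set.Icc (0 : ℝ) 1 := by
  rcases p with a | ω | ⟨e, x, hx0, hx1⟩
  · simp only [cutFun]; split_ifs <;> simp
  · simp only [cutFun]; split_ifs <;> simp
  · simp only [cutFun, Set.mem_Icc]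
    split_ifs <;> constructor <;> linarith

theorem cutFun_inner_of_iff {X : Set V} {e : E} (h : G.tail e ∈ X ↔ G.head e ∈ X)
    (x : Set.Ioo (0 : ℝ) 1) :
    cutFun X (.inner e x : G.Point) = cutFun X (.vertex (G.tail e) : G.Point) := by
  by_cases ht : G.tail e ∈ X
  · simp [cutFun, ht, h.1 ht]
  · have hh : G.head e ∉ X := fun k => ht (h.2 k)
    simp [cutFun, ht, hh]

theorem cutFun_inner_of_forward {X : Set V} {e : E} (h : G.tail e ∈ X) (h' : G.head e ∉ X)
    (x : Set.Ioo (0 : ℝ) 1) : cutFun X (.inner e x : G.Point) = x := by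
  simp [cutFun, h, h']

theorem cutFun_inner_of_backward {X : Set V} {e : E} (h : G.tail e ∉ X) (h' : G.head e ∈ X)
    (x : Set.Ioo (0 : ℝ) 1) : cutFun X (.inner e x : G.Point) = 1 - x := by
  simp [cutFun, h, h']

theorem abs_cutFun_inner_sub_le (X : Set V) (e : E) (x y : Set.Ioo (0 : ℝ) 1) :
    |cutFun X (.inner e y : G.Point) - cutFun X (.inner e x : G.Point)| ≤ |(y : ℝ) - x| := by
  have := abs_sub_comm (x : ℝ) y
  simp only [cutFun]
  split_ifs <;> ring_nf at * <;> simp [this]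

theorem abs_cutFun_inner_sub_tail_le (X : Set V) (e : E) (y : Set.Ioo (0 : ℝ) 1) :
    |cutFun X (.inner e y : G.Point) - cutFun X (.vertex (G.tail e) : G.Point)| ≤ y := by
  have := y.2.1.le
  simp only [cutFun]
  rw [abs_le]
  split_ifs <;> constructor <;> linarith

theorem abs_cutFun_inner_sub_head_le (X : Set V) (e : E) (y : Set.Ioo (0 : ℝ) 1) :
    |cutFun X (.inner e y : G.Point) - cutFun X (.vertex (G.head e) : G.Point)| ≤ 1 - y := by
  have := y.2.2.le
  simp only [cutFun]
  rw [abs_le]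
  split_ifs <;> constructor <;> linarith

open Classical in
-- Once the boundary vertices are deleted, the component in which the end lives is on one side of
-- the cut. This gives continuity of `cutFun X` at ends.
theorem cutFun_eq_of_mem_endNhd {X : Set V} (hX : G.FiniteBoundary X) {ω : G.Ends} {p : G.Point}
    (hp : p ∈ G.endNhd (G.boundaryVertices X) ω) : cutFun X p = cutFun X (.ofEnd ω) := by
  have hcomp : ∀ a ∈ G.endComponent (G.boundaryVertices X) ω,
      a ∉ G.boundaryVertices X ∧ (a ∈ X ↔ X ∈ nearby (.ofEnd ω : G.Point)) := by
    rintro a ⟨R, rfl, N, hN, hc⟩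
    refine ⟨hc.symm.notMem_left, ?_⟩
    rw [← mem_combClosure_iff hX (Or.inr ⟨_, rfl⟩), toEnd_mem_combClosure hX,
      ← hc.mem_iff subset_rfl]
    constructor
    · exact fun h => eventually_atTop.2 ⟨N, fun m hm =>
        ((R.connAvoiding_tail hN hm).mem_iff subset_rfl).1 h⟩
    · intro h
      obtain ⟨M, hM⟩ := eventually_atTop.1 h
      exact ((R.connAvoiding_tail hN (le_max_left N M)).mem_iff subset_rfl).2
        (hM _ (le_max_right N M))
  have hvert : ∀ a ∈ G.endComponent (G.boundaryVertices X) ω,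
      cutFun X (.vertex a : G.Point) = cutFun X (.ofEnd ω) := by
    intro a ha
    simp only [cutFun]
    exact if_congr (hcomp a ha).2 rfl rfl
  rcases p with a | ω' | ⟨e, x⟩
  · exact hvert a hp
  · obtain ⟨R, rfl, N, hN⟩ := hp
    have : X ∈ nearby (.ofEnd R.toEnd : G.Point) ↔ X ∈ nearby (.ofEnd ω : G.Point) := by
      rw [← mem_combClosure_iff hX (Or.inr ⟨_, rfl⟩), toEnd_mem_combClosure hX]
      constructor
      · intro h
        obtain ⟨M, hM⟩ := eventually_atTop.1 h
        exact (hcomp _ (hN _ (le_max_left N M))).2.1 (hM _ (le_max_right N M))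
      · exact fun h => eventually_atTop.2 ⟨N, fun m hm => (hcomp _ (hN m hm)).2.2 h⟩
    simp only [cutFun]
    exact if_congr this rfl rfl
  · rcases hp with hp | hp
    · rw [cutFun_inner_of_iff (tail_mem_iff_head_mem (Or.inl (hcomp _ hp).1)), hvert _ hp]
    · have h := tail_mem_iff_head_mem (Or.inr (hcomp _ hp).1)
      rw [cutFun_inner_of_iff h, ← hvert _ hp]
      simp only [cutFun]
      exact if_congr h rfl rfl

theorem continuous_cutFun {X : Set V} (hX : G.FiniteBoundary X) :
    Continuous (cutFun X : G.Point → ℝ) := by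
  refine continuous_def.2 fun U hU => ?_
  have hU' := Metric.isOpen_iff.1 hU
  refine ⟨fun e x hx => ?_, fun a ha => ⟨?_, ?_⟩, fun ω hω => ?_⟩
  · obtain ⟨ε, hε, hball⟩ := hU' _ hx
    exact ⟨ε, hε, fun y hy => hball ((abs_cutFun_inner_sub_le X e x y).trans_lt hy)⟩
  · rintro e rfl
    obtain ⟨ε, hε, hball⟩ := hU' _ ha
    exact ⟨ε, hε, fun y hy => hball ((abs_cutFun_inner_sub_tail_le X e y).trans_lt hy)⟩
  · rintro e rfl
    obtain ⟨ε, hε, hball⟩ := hU' _ ha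
    exact ⟨ε, hε, fun y hy => hball
      ((abs_cutFun_inner_sub_head_le X e y).trans_lt (by linarith))⟩
  · refine ⟨_, hX.finite_boundaryVertices, fun p hp => ?_⟩
    rw [Set.mem_preimage, cutFun_eq_of_mem_endNhd hX hp]
    exact hω

end Cuts

end DirMultigraph

namespace DirMultigraph

/-! ### Countability of the edge set and compactness of the space -/

section Compactness

open Filter

variable {V E : Type*} {G : DirMultigraph V E}

theorem LocallyFinite.finite_neighborSet (hlf : G.LocallyFinite) (a : V) :
    (G.adjGraph.neighborSet a).Finite := by
  refine Set.Finite.subset (((hlf a).image G.tail).union ((hlf a).image G.head)) ?_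
  rintro b ⟨e, ⟨rfl, rfl⟩ | ⟨rfl, rfl⟩⟩
  · exact Or.inr ⟨e, Or.inl rfl, rfl⟩
  · exact Or.inl ⟨e, Or.inr rfl, rfl⟩

theorem countable_edges (hlf : G.LocallyFinite) (hconn : G.WeaklyConnected) : Countable E := by
  have hball : ∀ (n : ℕ) (a : V), {b | ∃ p : G.adjGraph.Walk a b, p.length = n}.Countable := by
    intro n
    induction n with
    | zero =>
      refine fun a => (Set.countable_singleton a).mono ?_
      rintro b ⟨p, hp⟩
      exact (SimpleGraph.Walk.eq_of_length_eq_zero hp).symm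
    | succ n ih =>
      refine fun a => ((hlf.finite_neighborSet a).countable.biUnion fun c _ => ih c).mono ?_
      rintro b ⟨_ | ⟨hadj, p⟩, hp⟩
      · simp at hp
      · exact Set.mem_biUnion hadj ⟨p, by simpa using hp⟩
  obtain ⟨r⟩ := hconn.nonempty
  have hV : (Set.univ : Set V).Countable := by
    refine (Set.countable_iUnion fun n => hball n r).mono fun b _ => ?_
    obtain ⟨p⟩ := hconn.preconnected r b
    exact Set.mem_iUnion.2 ⟨p.length, p, rfl⟩
  refine Set.countable_univ_iff.1 ((hV.biUnion fun a _ => (hlf a).countable).mono fun e _ => ?_)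
  exact Set.mem_biUnion (Set.mem_univ (G.tail e)) (Or.inl rfl)

/-- A nonprincipal ultrafilter of vertices converges to an end. -/
theorem exists_end_of_ultrafilter (hlf : G.LocallyFinite) (hconn : G.WeaklyConnected)
    (𝓥 : Ultrafilter V) (h𝓥 : ∀ a, {a} ∉ 𝓥) :
    ∃ ω : G.Ends, ∀ S : Set V, S.Finite → G.endComponent S ω ∈ 𝓥 := by
  obtain ⟨r⟩ := hconn.nonempty
  have hconn' : G.adjGraph.Connected := hconn
  set d := G.adjGraph.dist with hd
  -- The ray is built from vertices lying on a geodesic from `r` to `x` for almost all `x`. As a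
  -- vertex has finitely many neighbours, the ultrafilter selects one of them as the next such
  -- vertex.
  have hstep : ∀ a : {a // ∀ᶠ x in 𝓥, d r x = d r a + d a x},
      ∃ b : {a // ∀ᶠ x in 𝓥, d r x = d r a + d a x},
        G.adjGraph.Adj a b ∧ d r b = d r a + 1 := by
    rintro ⟨a, ha⟩
    have hne : ∀ᶠ x in 𝓥, x ≠ a := Ultrafilter.compl_mem_iff_notMem.2 (h𝓥 a)
    have : ∀ᶠ x in 𝓥, ∃ b ∈ G.adjGraph.neighborSet a, d r b = d r a + 1 ∧
        d r x = d r b + d b x := by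
      filter_upwards [ha, hne] with x hx hxa
      obtain ⟨p, hp⟩ := hconn'.exists_walk_length_eq_dist a x
      cases p with
      | nil => exact absurd rfl hxa
      | @cons _ b _ hadj p =>
        rw [SimpleGraph.Walk.length_cons] at hp
        have h1 : d b x ≤ p.length := SimpleGraph.dist_le p
        have h2 : d r x ≤ d r b + d b x := hconn'.dist_triangle
        have h3 : d r b ≤ d r a + d a b := hconn'.dist_triangle
        have h4 : d a b ≤ 1 := by simpa using SimpleGraph.dist_le hadj.toWalk
        have h5 : p.length + 1 = d a x := hp
        exact ⟨b, hadj, by omega, by omega⟩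
    obtain ⟨b, hb, hb'⟩ :=
      (Ultrafilter.eventually_exists_mem_iff (hlf.finite_neighborSet a)).1 this
    obtain ⟨x, hx, _⟩ := hb'.exists
    exact ⟨⟨b, hb'.mono fun x hx => hx.2⟩, hb, hx⟩
  choose next hadj hdist using hstep
  let v : ℕ → {a // ∀ᶠ x in 𝓥, d r x = d r a + d a x} := fun n =>
    n.rec ⟨r, Eventually.of_forall fun x => by simp [hd]⟩ fun _ => next
  have hv : ∀ n, d r (v n).1 = n := by
    intro n
    induction n with
    | zero => simp [v, hd]
    | succ n ih =>
      change d r (next (v n)).1 = n + 1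
      rw [hdist, ih]
  have hedge : ∀ n, ∃ e, G.Joins e (v n).1 (v (n + 1)).1 := fun n => hadj (v n)
  choose edge hjoins using hedge
  let R : G.Ray := ⟨fun n => (v n).1, edge, hjoins, fun m n h => by
    have h' := congrArg (d r) h
    simpa only [hv] using h'⟩
  refine ⟨R.toEnd, fun S hS => ?_⟩
  obtain ⟨k, hk⟩ := (hS.image (d r)).bddAbove
  have hk' : ∀ a, k < d r a → a ∉ S := fun a ha haS => ha.not_ge (hk ⟨a, haS, rfl⟩)
  filter_upwards [(v (k + 1)).2] with x hx
  refine ⟨R, rfl, k + 1, fun n hn => hk' _ ?_, ?_⟩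
  · change k < d r (v n).1
    rw [hv]
    omega
  -- Every vertex on this geodesic is at distance at least `k + 1` from `r`, beyond all of `S`.
  · obtain ⟨p, hp⟩ := hconn'.exists_walk_length_eq_dist (v (k + 1)).1 x
    refine ⟨p, fun w hw => hk' w ?_⟩
    classical
    have h1 : d w x ≤ p.length := (SimpleGraph.dist_le (p.dropUntil w hw)).trans
      (SimpleGraph.Walk.length_dropUntil_le_length p hw)
    have h2 : d r x ≤ d r w + d w x := hconn'.dist_triangle
    have h3 : p.length = d (v (k + 1)).1 x := hp
    have h4 : d r (v (k + 1)).1 = k + 1 := hv (k + 1)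
    have h5 : d r x = d r (v (k + 1)).1 + d (v (k + 1)).1 x := hx
    omega

open Classical in
/-- The closed edge `e`, parametrised by the unit interval. -/
noncomputable def edgePath (G : DirMultigraph V E) (e : E) (x : unitInterval) : G.Point :=
  if h0 : (x : ℝ) = 0 then .vertex (G.tail e)
  else if h1 : (x : ℝ) = 1 then .vertex (G.head e)
  else .inner e ⟨x, lt_of_le_of_ne x.2.1 (Ne.symm h0), lt_of_le_of_ne x.2.2 h1⟩

theorem edgePath_zero (e : E) {x : unitInterval} (hx : (x : ℝ) = 0) :
    G.edgePath e x = .vertex (G.tail e) := by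
  simp [edgePath, hx]

theorem edgePath_one (e : E) {x : unitInterval} (hx : (x : ℝ) = 1) :
    G.edgePath e x = .vertex (G.head e) := by
  simp [edgePath, hx]

theorem edgePath_inner (e : E) {x : unitInterval} (hx : (x : ℝ) ∈ Set.Ioo (0 : ℝ) 1) :
    G.edgePath e x = .inner e ⟨x, hx⟩ := by
  simp [edgePath, hx.1.ne', hx.2.ne]

theorem continuous_edgePath (e : E) : Continuous (G.edgePath e) := by
  refine continuous_def.2 fun U hU => Metric.isOpen_iff.2 fun x hx => ?_
  obtain ⟨hi, hv, -⟩ := hU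
  rw [Set.mem_preimage] at hx
  have key : ∀ ε > (0 : ℝ), ∀ y : unitInterval, y ∈ Metric.ball x ε → |(y : ℝ) - x| < ε :=
    fun ε _ y hy => by rwa [Metric.mem_ball, Subtype.dist_eq, Real.dist_eq] at hy
  have cases : ∀ y : unitInterval, (y : ℝ) = 0 ∨ (y : ℝ) = 1 ∨ (y : ℝ) ∈ Set.Ioo (0 : ℝ) 1 := by
    intro y
    rcases y.2.1.eq_or_lt with h | h
    · exact Or.inl h.symm
    rcases y.2.2.eq_or_lt with h' | h'
    exacts [Or.inr (Or.inl h'), Or.inr (Or.inr ⟨h, h'⟩)]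
  rcases cases x with h | h | h
  · rw [edgePath_zero e h] at hx
    obtain ⟨ε, hε, hU⟩ := (hv _ hx).1 e rfl
    refine ⟨min ε 1, lt_min hε one_pos, fun y hy => ?_⟩
    have hy' := abs_lt.1 (key _ (lt_min hε one_pos) y hy)
    have h1 := min_le_left ε 1
    have h2 := min_le_right ε 1
    rw [Set.mem_preimage]
    rcases cases y with k | k | k
    · rwa [edgePath_zero e k]
    · linarith [hy'.2]
    · rw [edgePath_inner e k]
      exact hU ⟨y, k⟩ (by change (y : ℝ) < ε; linarith [hy'.2])
  · rw [edgePath_one e h] at hx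
    obtain ⟨ε, hε, hU⟩ := (hv _ hx).2 e rfl
    refine ⟨min ε 1, lt_min hε one_pos, fun y hy => ?_⟩
    have hy' := abs_lt.1 (key _ (lt_min hε one_pos) y hy)
    have h1 := min_le_left ε 1
    have h2 := min_le_right ε 1
    rw [Set.mem_preimage]
    rcases cases y with k | k | k
    · linarith [hy'.1]
    · rwa [edgePath_one e k]
    · rw [edgePath_inner e k]
      exact hU ⟨y, k⟩ (by change 1 - ε < (y : ℝ); linarith [hy'.1])
  · rw [edgePath_inner e h] at hx
    obtain ⟨ε, hε, hU⟩ := hi e _ hx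
    have hpos : 0 < min ε (min x (1 - x)) := lt_min hε (lt_min h.1 (by linarith [h.2]))
    refine ⟨_, hpos, fun y hy => ?_⟩
    have hy' := abs_lt.1 (key _ hpos y hy)
    have h1 := min_le_left ε (min (x : ℝ) (1 - x))
    have h2 := (min_le_right ε (min (x : ℝ) (1 - x))).trans (min_le_left _ _)
    have h3 := (min_le_right ε (min (x : ℝ) (1 - x))).trans (min_le_right _ _)
    have k : (y : ℝ) ∈ Set.Ioo (0 : ℝ) 1 := ⟨by linarith [hy'.1], by linarith [hy'.2]⟩
    rw [Set.mem_preimage, edgePath_inner e k]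
    exact hU ⟨y, k⟩ (abs_lt.2 ⟨by linarith [hy'.1], by linarith [hy'.2]⟩)

theorem compactSpace_point (hlf : G.LocallyFinite) (hconn : G.WeaklyConnected) :
    CompactSpace G.Point := by
  refine ⟨isCompact_iff_ultrafilter_le_nhds.2 fun 𝓤 _ => ?_⟩
  -- The ultrafilter is pushed to the vertices. If the result is principal at `a`, then `𝓤` lives on
  -- the finitely many closed edges at `a` together with `a`, a compact set; otherwise the pushed
  -- ultrafilter determines an end, and `𝓤` converges to it.
  have hbind : ∀ T : Set V, T ∈ 𝓤.bind nearby → {p | T ∈ nearby p} ∈ 𝓤 := fun T hT => hT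
  by_cases hprin : ∃ a, {a} ∈ 𝓤.bind nearby
  · obtain ⟨a, ha⟩ := hprin
    have hcomp : IsCompact
        ({.vertex a} ∪ ⋃ e ∈ {e | G.tail e = a ∨ G.head e = a}, Set.range (G.edgePath e)) :=
      isCompact_singleton.union
        ((hlf a).isCompact_biUnion fun e _ => isCompact_range (continuous_edgePath e))
    have hmem : ({.vertex a} ∪ ⋃ e ∈ {e | G.tail e = a ∨ G.head e = a},
        Set.range (G.edgePath e)) ∈ 𝓤 := by
      filter_upwards [hbind _ ha] with p hp
      rcases p with b | ω | ⟨e, x⟩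
      · exact Or.inl (congrArg Point.vertex (show b = a from hp))
      · refine absurd hp ?_
        change {a} ∉ (hyperfilter ℕ).map (Quotient.out ω : G.Ray).vert
        rw [Ultrafilter.mem_map]
        exact notMem_hyperfilter_of_finite
          ((Set.finite_singleton a).preimage (Quotient.out ω : G.Ray).inj.injOn)
      · refine Or.inr (Set.mem_biUnion (x := e) (Or.inl hp) ⟨⟨x, x.2.1.le, x.2.2.le⟩, ?_⟩)
        exact edgePath_inner e x.2
    obtain ⟨p, -, hp⟩ := isCompact_iff_ultrafilter_le_nhds.1 hcomp 𝓤 (le_principal_iff.2 hmem)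
    exact ⟨p, trivial, hp⟩
  · push Not at hprin
    obtain ⟨ω, hω⟩ := exists_end_of_ultrafilter hlf hconn _ hprin
    refine ⟨.ofEnd ω, trivial, le_nhds_iff.2 fun U hωU hU => ?_⟩
    obtain ⟨S, hS, hSU⟩ := hU.2.2 ω hωU
    filter_upwards [hbind _ (hω S hS)] with p hp
    refine hSU ?_
    rcases p with b | ω' | ⟨e, x⟩
    · exact hp
    · have hp' : (Quotient.out ω' : G.Ray).vert ⁻¹' G.endComponent S ω ∈ hyperfilter ℕ := hp
      obtain ⟨N, hN⟩ := (Quotient.out ω' : G.Ray).exists_tail_avoiding hS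
      have hge : Set.Ici N ∈ hyperfilter ℕ := Nat.hyperfilter_le_atTop (Ici_mem_atTop N)
      obtain ⟨n, hn, hNn⟩ := Ultrafilter.nonempty_of_mem (inter_mem hp' hge)
      refine ⟨Quotient.out ω', Quotient.out_eq ω', n, fun m hm => ?_⟩
      obtain ⟨R, hR, M, hM, hc⟩ := hn
      exact ⟨R, hR, M, hM, hc.trans (Ray.connAvoiding_tail _
        (fun k hk => hN k (le_trans hNn hk)) hm)⟩
    · exact Or.inl hp

end Compactness

end DirMultigraph

namespace DirMultigraph

/-! ### Minimal edge sets, tight cuts and the linear order they induce -/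

section TightCuts

variable {V E : Type*} {G : DirMultigraph V E} {s t : G.Point} {A : Set E}

/-- `X` and its complement form a finite cut separating `s` from `t`. -/
structure Splits (G : DirMultigraph V E) (s t : G.Point) (X : Set V) : Prop where
  finite : G.FiniteBoundary X
  source : X ∈ nearby s
  target : X ∉ nearby t

theorem Splits.inter {X Y : Set V} (hX : G.Splits s t X) (hY : G.Splits s t Y) :
    G.Splits s t (X ∩ Y) :=
  ⟨hX.finite.inter hY.finite, Filter.inter_mem hX.source hY.source,
    fun h => hX.target (Filter.mem_of_superset h Set.inter_subset_left)⟩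

theorem Splits.union {X Y : Set V} (hX : G.Splits s t X) (hY : G.Splits s t Y) :
    G.Splits s t (X ∪ Y) :=
  ⟨hX.finite.union hY.finite, Filter.mem_of_superset hX.source Set.subset_union_left,
    fun h => (Ultrafilter.union_mem_iff.1 h).elim hX.target hY.target⟩

/-- The finite cuts separating `s` from `t` are exactly the cuts given by `Splits`. -/
theorem isFiniteCut_and_mem_iff (hs : s ∈ G.verticesAndEnds) (ht : t ∈ G.verticesAndEnds)
    (X Y : Set V) : (G.IsFiniteCut X Y ∧ s ∈ G.combClosure X ∧ t ∈ G.combClosure Y) ↔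
      Y = Xᶜ ∧ G.Splits s t X := by
  constructor
  · rintro ⟨⟨hXY, hfin⟩, hsX, htY⟩
    obtain rfl : Y = Xᶜ := hXY.compl_eq.symm
    have hX : G.FiniteBoundary X := hfin
    exact ⟨rfl, hX, (mem_combClosure_iff hX hs).1 hsX,
      Ultrafilter.compl_mem_iff_notMem.1 ((mem_combClosure_iff hX.compl ht).1 htY)⟩
  · rintro ⟨rfl, hX, hsX, htX⟩
    exact ⟨⟨isCompl_compl, hX⟩, (mem_combClosure_iff hX hs).2 hsX,
      (mem_combClosure_iff hX.compl ht).2 (Ultrafilter.compl_mem_iff_notMem.2 htX)⟩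

theorem meetsCuts_iff (hs : s ∈ G.verticesAndEnds) (ht : t ∈ G.verticesAndEnds) :
    G.MeetsCuts s t A ↔ ∀ X, G.Splits s t X → ∃ e ∈ A, G.tail e ∈ X ∧ G.head e ∉ X := by
  constructor
  · intro h X hX
    obtain ⟨h1, h2, h3⟩ := (isFiniteCut_and_mem_iff hs ht X Xᶜ).2 ⟨rfl, hX⟩
    exact Set.one_le_encard_iff_nonempty.1 (h X Xᶜ h1 h2 h3)
  · intro h X Y h1 h2 h3
    obtain ⟨rfl, hX⟩ := (isFiniteCut_and_mem_iff hs ht X Y).1 ⟨h1, h2, h3⟩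
    exact Set.one_le_encard_iff_nonempty.2 (h X hX)

theorem BalancedOnCuts.meetsCuts (h : G.BalancedOnCuts s t A) : G.MeetsCuts s t A :=
  fun X Y hXY hs ht => (h X Y hXY hs ht).symm ▸ le_add_self

/-- Zorn's lemma applies since cuts are finite: a chain member with fewest edges leaving `X` shares
all of these with every other member, so the intersection of the chain still meets the cut. -/
theorem MeetsCuts.exists_minimal (h : G.MeetsCuts s t A) :
    ∃ B ⊆ A, Minimal (G.MeetsCuts s t) B := by
  refine zorn_superset_nonempty {B | G.MeetsCuts s t B} (fun c hc hchain hne => ?_) A h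
  refine ⟨⋂₀ c, fun X Y hXY hsX htY => ?_, fun B hB => Set.sInter_subset_of_mem hB⟩
  have hfin : (G.dirEdges X Y).Finite := hXY.2.subset Set.subset_union_left
  obtain ⟨B, hB, hmin⟩ : ∃ B ∈ c, ∀ C ∈ c,
      (B ∩ G.dirEdges X Y).ncard ≤ (C ∩ G.dirEdges X Y).ncard := by
    obtain ⟨B, hB⟩ := WellFounded.has_min (measure fun B : Set E => (B ∩ G.dirEdges X Y).ncard).wf
      c hne
    exact ⟨B, hB.1, fun C hC => not_lt.1 (hB.2 C hC)⟩
  obtain ⟨e, heB, he⟩ := Set.one_le_encard_iff_nonempty.1 (hc hB X Y hXY hsX htY)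
  refine Set.one_le_encard_iff_nonempty.2 ⟨e, Set.mem_sInter.2 fun C hC => ?_, he⟩
  rcases hchain.total hB hC with hBC | hCB
  · exact hBC heB
  · have heq := Set.eq_of_subset_of_ncard_le (Set.inter_subset_inter_left (G.dirEdges X Y) hCB)
      (hmin C hC) (hfin.subset Set.inter_subset_right)
    exact (heq ▸ (⟨heB, he⟩ : e ∈ B ∩ G.dirEdges X Y) : e ∈ C ∩ G.dirEdges X Y).1

/-- For each `e ∈ A`, the set `X e` defines a finite cut separating `s` from `t` that contains
`e`, directed away from `X e`, and no other edge of `A`. -/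
structure IsTightFamily (G : DirMultigraph V E) (s t : G.Point) (A : Set E) (X : E → Set V) :
    Prop where
  meets : ∀ Y, G.Splits s t Y → ∃ e ∈ A, G.tail e ∈ Y ∧ G.head e ∉ Y
  splits : ∀ e ∈ A, G.Splits s t (X e)
  tail_mem : ∀ e ∈ A, G.tail e ∈ X e
  head_notMem : ∀ e ∈ A, G.head e ∉ X e
  mem_iff : ∀ e ∈ A, ∀ g ∈ A, g ≠ e → (G.tail g ∈ X e ↔ G.head g ∈ X e)

theorem exists_isTightFamily (hs : s ∈ G.verticesAndEnds) (ht : t ∈ G.verticesAndEnds)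
    (hA : Minimal (G.MeetsCuts s t) A) : ∃ X, G.IsTightFamily s t A X := by
  have hmeets := (meetsCuts_iff hs ht).1 hA.1
  have hex : ∀ e ∈ A, ∃ X, G.Splits s t X ∧ ∀ g ∈ A, G.tail g ∈ X → G.head g ∉ X → g = e := by
    intro e he
    by_contra! hno
    have hdel : G.MeetsCuts s t (A \ {e}) := (meetsCuts_iff hs ht).2 fun X hX => by
      obtain ⟨g, hg, h1, h2, h3⟩ := hno X hX
      exact ⟨g, ⟨hg, h3⟩, h1, h2⟩
    exact (hA.2 hdel Set.sdiff_subset he).2 rfl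
  have hex' : ∀ e : E, ∃ X, e ∈ A →
      G.Splits s t X ∧ ∀ g ∈ A, G.tail g ∈ X → G.head g ∉ X → g = e := by
    intro e
    by_cases he : e ∈ A
    · obtain ⟨X, hX⟩ := hex e he
      exact ⟨X, fun _ => hX⟩
    · exact ⟨∅, fun h => absurd h he⟩
  choose X hX using hex'
  have hcross : ∀ e ∈ A, G.tail e ∈ X e ∧ G.head e ∉ X e := by
    intro e he
    obtain ⟨g, hg, h1, h2⟩ := hmeets _ (hX e he).1
    obtain rfl := (hX e he).2 g hg h1 h2
    exact ⟨h1, h2⟩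
  refine ⟨X, hmeets, fun e he => (hX e he).1, fun e he => (hcross e he).1,
    fun e he => (hcross e he).2, fun e he k hk hne => ?_⟩
  by_contra hcontra
  have htail : G.tail k ∉ X e := fun h1 => hcontra
    ⟨fun _ => by_contra fun h2 => hne ((hX e he).2 k hk h1 h2), fun _ => h1⟩
  have hhead : G.head k ∈ X e := by tauto
  -- Here `k` enters `X e`. Only `e` or `k` can leave the union or the intersection of `X e` and `X
  -- k`, and `k` leaves neither. So `e` leaves both, hence leaves `X k`, which only `k` may do.
  obtain ⟨g, hg, h1, h2⟩ := hmeets _ ((hX e he).1.union (hX k hk).1)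
  rw [Set.mem_union] at h1 h2
  push Not at h2
  obtain ⟨g', hg', h1', h2'⟩ := hmeets _ ((hX e he).1.inter (hX k hk).1)
  rw [Set.mem_inter_iff] at h1' h2'
  have hge : g = e ∨ g = k :=
    h1.imp (fun h => (hX e he).2 g hg h h2.1) (fun h => (hX k hk).2 g hg h h2.2)
  have hge' : g' = e ∨ g' = k := by
    by_cases h : G.head g' ∈ X e
    · exact Or.inr ((hX k hk).2 g' hg' h1'.2 fun h' => h2' ⟨h, h'⟩)
    · exact Or.inl ((hX e he).2 g' hg' h1'.1 h)
  have hg_e : g = e := hge.resolve_right fun h => h2.1 (h ▸ hhead)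
  have hg'_e : g' = e := hge'.resolve_right fun h => htail (h ▸ h1'.1)
  subst hg_e
  subst hg'_e
  exact hne ((hX k hk).2 g' hg' h1'.2 h2.2).symm

namespace IsTightFamily

variable {X : E → Set V}

/-- Totality and antisymmetry of the order. If both tails lay in the other set, no edge of `A` would
leave the union; if neither did, none would leave the intersection. -/
theorem tail_mem_iff (hX : G.IsTightFamily s t A X) {e f : E} (he : e ∈ A) (hf : f ∈ A)
    (hne : e ≠ f) : G.tail e ∈ X f ↔ G.tail f ∉ X e := by
  constructor
  · intro h h'
    obtain ⟨g, hg, h1, h2⟩ := hX.meets _ ((hX.splits e he).union (hX.splits f hf))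
    rw [Set.mem_union] at h1 h2
    push Not at h2
    by_cases hge : g = e
    · subst hge
      exact h2.2 ((hX.mem_iff f hf g hg hne).1 h)
    by_cases hgf : g = f
    · subst hgf
      exact h2.1 ((hX.mem_iff e he g hg hge).1 h')
    rw [hX.mem_iff e he g hg hge, hX.mem_iff f hf g hg hgf] at h1
    exact h1.elim h2.1 h2.2
  · intro h'
    by_contra h
    obtain ⟨g, hg, h1, h2⟩ := hX.meets _ ((hX.splits e he).inter (hX.splits f hf))
    rw [Set.mem_inter_iff] at h1 h2
    by_cases hge : g = e
    · subst hge
      exact h h1.2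
    by_cases hgf : g = f
    · subst hgf
      exact h' h1.1
    rw [hX.mem_iff e he g hg hge, hX.mem_iff f hf g hg hgf] at h1
    exact h2 h1

/-- Were this false, the three edges would form a cycle in the order and no edge of `A` would leave
the intersection of the three sets. -/
theorem trans (hX : G.IsTightFamily s t A X) {e f g : E} (he : e ∈ A) (hf : f ∈ A) (hg : g ∈ A)
    (hef : e ≠ f) (hfg : f ≠ g) (h : G.tail e ∈ X f) (h' : G.tail f ∈ X g) :
    G.tail e ∈ X g := by
  have hef' := (hX.tail_mem_iff he hf hef).1 h
  have hfg' := (hX.tail_mem_iff hf hg hfg).1 h'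
  by_contra hcontra
  obtain ⟨k, hk, h1, h2⟩ := hX.meets _
    (((hX.splits e he).inter (hX.splits f hf)).inter (hX.splits g hg))
  simp only [Set.mem_inter_iff] at h1 h2
  by_cases hke : k = e
  · subst hke
    exact hcontra h1.2
  by_cases hkf : k = f
  · subst hkf
    exact hef' h1.1.1
  by_cases hkg : k = g
  · subst hkg
    exact hfg' h1.1.2
  rw [hX.mem_iff e he k hk hke, hX.mem_iff f hf k hk hkf, hX.mem_iff g hg k hk hkg] at h1
  exact h2 h1

end IsTightFamily

end TightCuts

end DirMultigraph

namespace DirMultigraph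

/-! ### Net outflow across separating cuts -/

section Balance

variable {V E : Type*} {G : DirMultigraph V E} {s t : G.Point} {A : Set E}

/-- The number of edges of `A` leaving `X` minus the number of edges of `A` entering `X`. -/
noncomputable def netOutflow (G : DirMultigraph V E) (A : Set E) (X : Set V) : ℤ :=
  (A ∩ G.dirEdges X Xᶜ).ncard - (A ∩ G.dirEdges Xᶜ X).ncard

open Classical in
theorem netOutflow_eq_sum (X : Set V) (F : Finset E) (hFA : ↑F ⊆ A)
    (hF : A ∩ G.edgesBetween X Xᶜ ⊆ F) : G.netOutflow A X =
      ∑ e ∈ F, ((if G.tail e ∈ X then 1 else 0) - (if G.head e ∈ X then 1 else 0)) := by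
  have h1 : A ∩ G.dirEdges X Xᶜ = ↑(F.filter fun e => G.tail e ∈ X ∧ G.head e ∉ X) := by
    ext e
    simp only [Finset.coe_filter, Set.mem_inter_iff, dirEdges, Set.mem_ofPred_eq,
      Set.mem_compl_iff]
    exact ⟨fun h => ⟨hF ⟨h.1, Or.inl h.2⟩, h.2⟩, fun h => ⟨hFA h.1, h.2⟩⟩
  have h2 : A ∩ G.dirEdges Xᶜ X = ↑(F.filter fun e => G.tail e ∉ X ∧ G.head e ∈ X) := by
    ext e
    simp only [Finset.coe_filter, Set.mem_inter_iff, dirEdges, Set.mem_ofPred_eq,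
      Set.mem_compl_iff]
    exact ⟨fun h => ⟨hF ⟨h.1, Or.inr h.2⟩, h.2⟩, fun h => ⟨hFA h.1, h.2⟩⟩
  rw [netOutflow, h1, h2, Set.ncard_coe_finset, Set.ncard_coe_finset, Finset.card_filter,
    Finset.card_filter, Nat.cast_sum, Nat.cast_sum, ← Finset.sum_sub_distrib]
  refine Finset.sum_congr rfl fun e _ => ?_
  by_cases ht : G.tail e ∈ X <;> by_cases hh : G.head e ∈ X <;> simp [ht, hh]

/-- Net outflow is a finite sum of differences of indicators, and indicators are modular. -/
theorem netOutflow_inter_add_union {X Y : Set V} (hX : G.FiniteBoundary X)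
    (hY : G.FiniteBoundary Y) : G.netOutflow A (X ∩ Y) + G.netOutflow A (X ∪ Y) =
      G.netOutflow A X + G.netOutflow A Y := by
  classical
  have hfin : (A ∩ (G.edgesBetween X Xᶜ ∪ G.edgesBetween Y Yᶜ)).Finite :=
    (Set.Finite.union hX hY).subset Set.inter_subset_right
  have hmem : ∀ Z : Set V, (∀ e, (G.tail e ∈ X ↔ G.head e ∈ X) → (G.tail e ∈ Y ↔ G.head e ∈ Y) →
      (G.tail e ∈ Z ↔ G.head e ∈ Z)) → A ∩ G.edgesBetween Z Zᶜ ⊆ hfin.toFinset := by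
    rintro Z hZ e ⟨heA, he⟩
    rw [mem_edgesBetween_compl] at he
    simp only [Set.Finite.coe_toFinset, Set.mem_inter_iff, Set.mem_union, mem_edgesBetween_compl]
    have := hZ e
    tauto
  have hsub : ↑hfin.toFinset ⊆ A := by
    rw [Set.Finite.coe_toFinset]
    exact Set.inter_subset_left
  rw [netOutflow_eq_sum _ _ hsub (hmem X fun e h _ => h),
    netOutflow_eq_sum _ _ hsub (hmem Y fun e _ h => h),
    netOutflow_eq_sum _ _ hsub (hmem (X ∩ Y) fun e h h' => by
      simp only [Set.mem_inter_iff, h, h']),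
    netOutflow_eq_sum _ _ hsub (hmem (X ∪ Y) fun e h h' => by
      simp only [Set.mem_union, h, h']),
    ← Finset.sum_add_distrib, ← Finset.sum_add_distrib]
  refine Finset.sum_congr rfl fun e _ => ?_
  simp only [Set.mem_inter_iff, Set.mem_union]
  by_cases h1 : G.tail e ∈ X <;> by_cases h2 : G.tail e ∈ Y <;>
    by_cases h3 : G.head e ∈ X <;> by_cases h4 : G.head e ∈ Y <;> simp [h1, h2, h3, h4]

namespace IsTightFamily

variable {X : E → Set V}

theorem netOutflow_eq_one (hX : G.IsTightFamily s t A X) {e : E} (he : e ∈ A) :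
    G.netOutflow A (X e) = 1 := by
  have h1 : A ∩ G.dirEdges (X e) (X e)ᶜ = {e} := by
    refine Set.eq_singleton_iff_unique_mem.2
      ⟨⟨he, hX.tail_mem e he, hX.head_notMem e he⟩, fun g hg => ?_⟩
    by_contra hne
    exact hg.2.2 ((hX.mem_iff e he g hg.1 hne).1 hg.2.1)
  have h2 : A ∩ G.dirEdges (X e)ᶜ (X e) = ∅ := by
    refine Set.eq_empty_iff_forall_notMem.2 fun g hg => hg.2.1 ?_
    by_cases hne : g = e
    · subst hne
      exact absurd hg.2.2 (hX.head_notMem g he)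
    · exact (hX.mem_iff e he g hg.1 hne).2 hg.2.2
  simp [netOutflow, h1, h2]

/-- If `e` preceded `f`, no edge of `A` would leave `X e ∪ (Yᶜ ∩ X f)`: the head of `e` lies in the
second part, the tail of `f` does not, and no edge of `A` re-enters `Y`. By totality of the order,
two distinct edges of `A` cannot both leave `Y`. -/
theorem not_two_forward (hX : G.IsTightFamily s t A X) {Y : Set V} (hY : G.Splits s t Y)
    (hback : ∀ g ∈ A, G.head g ∈ Y → G.tail g ∈ Y) {e f : E} (he : e ∈ A) (hf : f ∈ A)
    (he' : G.head e ∉ Y) (hf' : G.tail f ∈ Y) (hne : e ≠ f) : G.tail e ∉ X f := by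
  intro hef
  have hXe := hX.splits e he
  have hXf := hX.splits f hf
  obtain ⟨g, hg, h1, h2⟩ := hX.meets (X e ∪ (Yᶜ ∩ X f))
    ⟨hXe.finite.union (hY.finite.compl.inter hXf.finite),
      Filter.mem_of_superset hXe.source Set.subset_union_left,
      fun h => (Ultrafilter.union_mem_iff.1 h).elim hXe.target
        fun h => hXf.target (Filter.mem_of_superset h Set.inter_subset_right)⟩
  simp only [Set.mem_union, Set.mem_inter_iff, Set.mem_compl_iff] at h1 h2
  push Not at h2
  by_cases hge : g = e
  · subst hge
    exact h2.2 he' ((hX.mem_iff f hf g hg hne).1 hef)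
  have h3 := h1.resolve_left fun h => h2.1 ((hX.mem_iff e he g hg hge).1 h)
  have h4 := h2.2 fun h => h3.1 (hback g hg h)
  by_cases hgf : g = f
  · subst hgf
    exact h3.1 hf'
  · exact h4 ((hX.mem_iff f hf g hg hgf).1 h3.2)

/-- The descent step of both uncrossing inductions: combining `Y` with `X e` can create no new
crossing except at `e`, and `Z` is chosen so that `e` no longer crosses. -/
theorem ncard_crossing_lt (hX : G.IsTightFamily s t A X) {Y Z : Set V} (hY : G.FiniteBoundary Y)
    {e : E} (he : e ∈ A) (heY : ¬(G.tail e ∈ Y ↔ G.head e ∈ Y))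
    (hZ : ∀ g, g ≠ e → (G.tail g ∈ Y ↔ G.head g ∈ Y) → (G.tail g ∈ X e ↔ G.head g ∈ X e) →
      (G.tail g ∈ Z ↔ G.head g ∈ Z)) (heZ : G.tail e ∈ Z ↔ G.head e ∈ Z) :
    (A ∩ G.edgesBetween Z Zᶜ).ncard < (A ∩ G.edgesBetween Y Yᶜ).ncard := by
  have hfin : (A ∩ G.edgesBetween Y Yᶜ).Finite := Set.Finite.subset hY Set.inter_subset_right
  refine Set.ncard_lt_ncard (Set.ssubset_iff_of_subset ?_ |>.2
    ⟨e, ⟨he, mem_edgesBetween_compl.2 heY⟩, fun h => mem_edgesBetween_compl.1 h.2 heZ⟩) hfin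
  rintro g ⟨hg, hgZ⟩
  rw [mem_edgesBetween_compl] at hgZ
  refine ⟨hg, mem_edgesBetween_compl.2 fun hgY => hgZ ?_⟩
  by_cases hge : g = e
  · rwa [hge]
  · exact hZ g hge hgY (hX.mem_iff e he g hg hge)

theorem netOutflow_eq_one_of_splits (hX : G.IsTightFamily s t A X) {Y : Set V}
    (hY : G.Splits s t Y) : G.netOutflow A Y = 1 := by
  induction hn : (A ∩ G.edgesBetween Y Yᶜ).ncard using Nat.strong_induction_on generalizing Y with
  | _ n ih =>
  subst hn
  by_cases hback : ∀ g ∈ A, G.head g ∈ Y → G.tail g ∈ Y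
  · obtain ⟨e, he, h1, h2⟩ := hX.meets Y hY
    have hfwd : A ∩ G.dirEdges Y Yᶜ = {e} := by
      refine Set.eq_singleton_iff_unique_mem.2 ⟨⟨he, h1, h2⟩, fun f hf => ?_⟩
      by_contra hne
      exact hX.not_two_forward hY hback hf.1 he hf.2.2 h1 hne ((hX.tail_mem_iff hf.1 he hne).2
        (hX.not_two_forward hY hback he hf.1 h2 hf.2.1 (Ne.symm hne)))
    have hbwd : A ∩ G.dirEdges Yᶜ Y = ∅ :=
      Set.eq_empty_iff_forall_notMem.2 fun g hg => hg.2.1 (hback g hg.1 hg.2.2)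
    simp [netOutflow, hfwd, hbwd]
  · push Not at hback
    obtain ⟨e, he, h1, h2⟩ := hback
    -- The edge `e` enters `Y` but leaves `X e`, so it crosses neither their intersection nor their
    -- union. Modularity then reads `1 + 1 = netOutflow Y + 1`.
    have hmod := netOutflow_inter_add_union (A := A) hY.finite (hX.splits e he).finite
    have hlt {Z : Set V} := hX.ncard_crossing_lt (Z := Z) hY.finite he (by tauto)
    have hte := hX.tail_mem e he
    have hhe := hX.head_notMem e he
    rw [ih _ (hlt (Z := Y ∩ X e) (fun g _ h h' => by simp only [Set.mem_inter_iff, h, h']) (by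
        simp [h2, hhe])) (hY.inter (hX.splits e he)) rfl,
      ih _ (hlt (Z := Y ∪ X e) (fun g _ h h' => by simp only [Set.mem_union, h, h']) (by
        simp [h1, hte])) (hY.union (hX.splits e he)) rfl, hX.netOutflow_eq_one he] at hmod
    linarith

end IsTightFamily

theorem balancedOnCuts_of_minimal (hs : s ∈ G.verticesAndEnds) (ht : t ∈ G.verticesAndEnds)
    (hA : Minimal (G.MeetsCuts s t) A) : G.BalancedOnCuts s t A := by
  obtain ⟨Z, hZ⟩ := exists_isTightFamily hs ht hA
  intro X Y h1 h2 h3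
  obtain ⟨rfl, hX⟩ := (isFiniteCut_and_mem_iff hs ht X Y).1 ⟨h1, h2, h3⟩
  have h := hZ.netOutflow_eq_one_of_splits hX
  have hfin1 : (A ∩ G.dirEdges X Xᶜ).Finite :=
    hX.finite.subset (Set.inter_subset_right.trans Set.subset_union_left)
  have hfin2 : (A ∩ G.dirEdges Xᶜ X).Finite :=
    hX.finite.subset (Set.inter_subset_right.trans Set.subset_union_right)
  rw [← hfin1.cast_ncard_eq, ← hfin2.cast_ncard_eq]
  rw [netOutflow] at h
  exact_mod_cast (by linarith :
    ((A ∩ G.dirEdges X Xᶜ).ncard : ℤ) = (A ∩ G.dirEdges Xᶜ X).ncard + 1)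

end Balance

end DirMultigraph

namespace DirMultigraph

/-! ### The position function and its injectivity -/

section Position

variable {V E : Type*} {G : DirMultigraph V E} {s t : G.Point} {A : Set E}

theorem isOpen_inner (e : E) : IsOpen {p : G.Point | ∃ x, p = .inner e x} := by
  refine ⟨?_, ?_, ?_⟩
  · rintro _ _ ⟨x, hx⟩
    cases hx
    exact ⟨1, one_pos, fun y _ => ⟨y, rfl⟩⟩
  · rintro a ⟨x, hx⟩
    cases hx
  · rintro a ⟨x, hx⟩
    cases hx

theorem inner_mem_edgeClosure {e : E} {x : Set.Ioo (0 : ℝ) 1} :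
    Point.inner e x ∈ G.edgeClosure A ↔ e ∈ A := by
  refine ⟨fun h => ?_, fun h => subset_closure h⟩
  obtain ⟨_, ⟨y, rfl⟩, hy⟩ := mem_closure_iff.1 h _ (isOpen_inner e) ⟨x, rfl⟩
  exact hy

theorem mem_verticesAndEnds_or_inner (p : G.Point) :
    p ∈ G.verticesAndEnds ∨ ∃ e x, p = .inner e x := by
  rcases p with a | ω | ⟨e, x⟩
  exacts [Or.inl (Or.inl ⟨a, rfl⟩), Or.inl (Or.inr ⟨ω, rfl⟩), Or.inr ⟨e, x, rfl⟩]

namespace IsTightFamily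

variable {X : E → Set V}

theorem exists_tail_mem (M : Set V) (hM : G.FiniteBoundary M)
    (hcross : ∀ g ∈ A, G.tail g ∈ M ↔ G.head g ∈ M) {p : G.Point} (hp : p ∈ G.edgeClosure A)
    (hpM : cutFun M p = 0) : ∃ g ∈ A, G.tail g ∈ M := by
  obtain ⟨z, hz, hzA⟩ := mem_closure_iff.1 hp _
    ((isOpen_Iio (a := (1 : ℝ))).preimage (continuous_cutFun hM))
    (by simp [hpM])
  have hvert : ∀ a, cutFun M (.vertex a : G.Point) < 1 → a ∈ M := by
    intro a ha
    by_contra h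
    simp [cutFun, h] at ha
  rcases z with a | ω | ⟨e, x⟩
  · obtain ⟨g, hg, h | h⟩ := hzA
    · exact ⟨g, hg, h ▸ hvert a hz⟩
    · exact ⟨g, hg, (hcross g hg).2 (h ▸ hvert a hz)⟩
  · exact hzA.elim
  · refine ⟨e, hzA, hvert _ ?_⟩
    rwa [← cutFun_inner_of_iff (hcross e hzA) x]

/-- A finite cut containing no edge of `A` does not separate a vertex or end in the closure of
`A` from `t`. -/
theorem notMem_nearby_of_isolated (hX : G.IsTightFamily s t A X) {M : Set V}
    (hM : G.FiniteBoundary M) (hcross : ∀ g ∈ A, G.tail g ∈ M ↔ G.head g ∈ M)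
    (ht : M ∉ nearby t) {p : G.Point} (hpV : p ∈ G.verticesAndEnds)
    (hp : p ∈ G.edgeClosure A) : M ∉ nearby p := by
  intro hpM
  obtain ⟨g, hg, hgM⟩ := exists_tail_mem M hM hcross hp (cutFun_eq_zero hpV hpM)
  have hXg := hX.splits g hg
  -- No edge of `A` can leave `X g ∪ M`: the only one leaving `X g` is `g`, which lies inside `M`.
  obtain ⟨k, hk, h1, h2⟩ := hX.meets (X g ∪ M) ⟨hXg.finite.union hM,
    Filter.mem_of_superset hXg.source Set.subset_union_left,
    fun h => (Ultrafilter.union_mem_iff.1 h).elim hXg.target ht⟩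
  rw [Set.mem_union] at h1 h2
  push Not at h2
  by_cases hkg : k = g
  · subst hkg
    exact h2.2 ((hcross k hk).1 hgM)
  · rw [hX.mem_iff g hg k hk hkg, hcross k hk] at h1
    exact h1.elim h2.1 h2.2

/-- Since `p` and `q` are on the same side of `X e`, intersecting `Y` with that side or adding the
opposite side still separates them; one of the two choices removes the crossing at `e`. -/
theorem exists_uncrossed (hX : G.IsTightFamily s t A X) {p q : G.Point}
    (h : ∀ e ∈ A, X e ∈ nearby p ↔ X e ∈ nearby q) {Y : Set V} (hY : G.FiniteBoundary Y)
    (hpY : Y ∈ nearby p) (hqY : Y ∉ nearby q) :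
    ∃ M, G.FiniteBoundary M ∧ M ∈ nearby p ∧ M ∉ nearby q ∧
      ∀ g ∈ A, G.tail g ∈ M ↔ G.head g ∈ M := by
  induction hn : (A ∩ G.edgesBetween Y Yᶜ).ncard using Nat.strong_induction_on generalizing Y with
  | _ n ih =>
  subst hn
  by_cases hcross : ∀ g ∈ A, G.tail g ∈ Y ↔ G.head g ∈ Y
  · exact ⟨Y, hY, hpY, hqY, hcross⟩
  push Not at hcross
  obtain ⟨e, he, heY⟩ := hcross
  have hlt {Z : Set V} := hX.ncard_crossing_lt (Z := Z) hY he (by tauto)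
  have hte := hX.tail_mem e he
  have hhe := hX.head_notMem e he
  have hXe := (hX.splits e he).finite
  have hinter : ∀ Z : Set V, G.FiniteBoundary Z → Z ∈ nearby p → (∀ g, g ≠ e →
      (G.tail g ∈ X e ↔ G.head g ∈ X e) → (G.tail g ∈ Z ↔ G.head g ∈ Z)) →
      (G.tail e ∈ Y ∩ Z ↔ G.head e ∈ Y ∩ Z) → ∃ M, G.FiniteBoundary M ∧ M ∈ nearby p ∧
      M ∉ nearby q ∧ ∀ g ∈ A, G.tail g ∈ M ↔ G.head g ∈ M := by
    intro Z hZ hpZ hiff heZ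
    refine ih _ (hlt (Z := Y ∩ Z) (fun g hg h1 h2 => ?_) heZ) (hY.inter hZ)
      (Filter.inter_mem hpY hpZ)
      (fun h => hqY (Filter.mem_of_superset h Set.inter_subset_left)) rfl
    simp only [Set.mem_inter_iff, h1, hiff g hg h2]
  have hunion : ∀ Z : Set V, G.FiniteBoundary Z → Z ∉ nearby q → (∀ g, g ≠ e →
      (G.tail g ∈ X e ↔ G.head g ∈ X e) → (G.tail g ∈ Z ↔ G.head g ∈ Z)) →
      (G.tail e ∈ Y ∪ Z ↔ G.head e ∈ Y ∪ Z) → ∃ M, G.FiniteBoundary M ∧ M ∈ nearby p ∧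
      M ∉ nearby q ∧ ∀ g ∈ A, G.tail g ∈ M ↔ G.head g ∈ M := by
    intro Z hZ hqZ hiff heZ
    refine ih _ (hlt (Z := Y ∪ Z) (fun g hg h1 h2 => ?_) heZ) (hY.union hZ)
      (Filter.mem_of_superset hpY Set.subset_union_left)
      (fun h => (Ultrafilter.union_mem_iff.1 h).elim hqY hqZ) rfl
    simp only [Set.mem_union, h1, hiff g hg h2]
  by_cases hp : X e ∈ nearby p
  · by_cases ht : G.tail e ∈ Y
    · exact hunion (X e)ᶜ hXe.compl (fun h' => Ultrafilter.compl_mem_iff_notMem.1 h' ((h e he).1 hp))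
        (fun g _ hg => not_congr hg) (by simp [ht, hhe])
    · exact hinter (X e) hXe hp (fun g _ hg => hg) (by simp [ht, hhe])
  · by_cases ht : G.tail e ∈ Y
    · have hh : G.head e ∉ Y := by tauto
      exact hinter (X e)ᶜ hXe.compl (Ultrafilter.compl_mem_iff_notMem.2 hp)
        (fun g _ hg => not_congr hg) (by simp [hh, hte])
    · have hh : G.head e ∈ Y := by tauto
      exact hunion (X e) hXe (fun h' => hp ((h e he).2 h'))
        (fun g _ hg => hg) (by simp [hh, hte])

/-- An uncrossed cut separating `p` from `q` has `s` and `t` on one side, so the point on the other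
side is cut off from `A`. Allowing `s` and `t` themselves is needed later to show that they lie in
the closure of `A`. -/
theorem eq_of_forall_mem_nearby_iff (hX : G.IsTightFamily s t A X) (hlf : G.LocallyFinite)
    {p q : G.Point} (hpV : p ∈ G.verticesAndEnds) (hqV : q ∈ G.verticesAndEnds)
    (hp : p ∈ G.edgeClosure A ∨ p = s ∨ p = t) (hq : q ∈ G.edgeClosure A ∨ q = s ∨ q = t)
    (h : ∀ e ∈ A, X e ∈ nearby p ↔ X e ∈ nearby q) : p = q := by
  by_contra hpq
  obtain ⟨Y, hY, hpY, hqY⟩ := hlf.exists_separating hpV hqV hpq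
  obtain ⟨M, hM, hpM, hqM, hcross⟩ := hX.exists_uncrossed h hY hpY hqY
  have hst : ∀ M : Set V, G.FiniteBoundary M → (∀ g ∈ A, G.tail g ∈ M ↔ G.head g ∈ M) →
      M ∈ nearby s → M ∈ nearby t := by
    intro M hM hcross hs
    by_contra ht
    obtain ⟨g, hg, h1, h2⟩ := hX.meets M ⟨hM, hs, ht⟩
    exact h2 ((hcross g hg).1 h1)
  have hcross' : ∀ g ∈ A, G.tail g ∈ Mᶜ ↔ G.head g ∈ Mᶜ := fun g hg => not_congr (hcross g hg)
  by_cases hs : M ∈ nearby s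
  · have ht := hst M hM hcross hs
    rcases hq with hq | rfl | rfl
    · exact hX.notMem_nearby_of_isolated hM.compl hcross'
        (fun h' => Ultrafilter.compl_mem_iff_notMem.1 h' ht) hqV hq
        (Ultrafilter.compl_mem_iff_notMem.2 hqM)
    · exact hqM hs
    · exact hqM ht
  · have ht : M ∉ nearby t := Ultrafilter.compl_mem_iff_notMem.1
      (hst Mᶜ hM.compl hcross' (Ultrafilter.compl_mem_iff_notMem.2 hs))
    rcases hp with hp | rfl | rfl
    · exact hX.notMem_nearby_of_isolated hM hcross ht hpV hp hpM
    · exact hs hpM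
    · exact ht hpM

/-- When `e` precedes `g`, the function of `g` starts to grow only after that of `e` has reached 1.
The condition is closed, so it suffices to check it on the edges of `A`. -/
theorem cutFun_eq_zero_or_eq_one (hX : G.IsTightFamily s t A X) {e g : E} (he : e ∈ A)
    (hg : g ∈ A) (hne : e ≠ g) (h : G.tail e ∈ X g) {p : G.Point} (hp : p ∈ G.edgeClosure A) :
    cutFun (X g) p = 0 ∨ cutFun (X e) p = 1 := by
  have hclosed : IsClosed {p : G.Point | cutFun (X g) p = 0 ∨ cutFun (X e) p = 1} :=
    (isClosed_singleton.preimage (continuous_cutFun (hX.splits g hg).finite)).union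
      (isClosed_singleton.preimage (continuous_cutFun (hX.splits e he).finite))
  have hend : ∀ k ∈ A, k ≠ e → G.tail k ∈ X e → G.tail k ∈ X g ∧ G.head k ∈ X g := by
    intro k hk hke hkX
    have hkg : k ≠ g := by
      rintro rfl
      exact (hX.tail_mem_iff he hg hne).1 h hkX
    have := hX.trans hk he hg hke hne hkX h
    exact ⟨this, (hX.mem_iff g hg k hk hkg).1 this⟩
  have heg : G.head e ∈ X g := (hX.mem_iff g hg e he hne).1 h
  refine hclosed.closure_subset_iff.2 ?_ hp
  rintro (a | ω | ⟨k, x⟩) hz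
  · obtain ⟨k, hk, hka⟩ := hz
    by_cases hae : a ∈ X e
    · refine Or.inl ?_
      suffices a ∈ X g by simp [cutFun, this]
      by_cases hke : k = e
      · subst hke
        rcases hka with rfl | rfl
        exacts [h, heg]
      · have hkX : G.tail k ∈ X e := by
          rcases hka with rfl | rfl
          exacts [hae, (hX.mem_iff e he k hk hke).2 hae]
        rcases hka with rfl | rfl
        exacts [(hend k hk hke hkX).1, (hend k hk hke hkX).2]
    · exact Or.inr (by simp [cutFun, hae])
  · exact hz.elim
  · by_cases hke : k = e
    · subst hke
      exact Or.inl (by simp [cutFun, h, heg])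
    by_cases hkX : G.tail k ∈ X e
    · have := hend k hz hke hkX
      exact Or.inl (by simp [cutFun, this.1, this.2])
    · have hkX' : G.head k ∉ X e := fun h' => hkX ((hX.mem_iff e he k hz hke).2 h')
      exact Or.inr (by simp [cutFun, hkX, hkX'])

end IsTightFamily

/-- The weighted average of the functions `cutFun (X e)`, for `e ∈ A`. -/
noncomputable def position (X : E → Set V) (w : A → ℝ) (p : G.Point) : ℝ :=
  ∑' e : A, w e * cutFun (X e) p

section

variable {X : E → Set V} {w : A → ℝ}

theorem summable_position (hpos : ∀ e, 0 < w e) (hsum : HasSum w 1) (p : G.Point) :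
    Summable fun e : A => w e * cutFun (X e) p :=
  Summable.of_nonneg_of_le (fun e => mul_nonneg (hpos e).le (cutFun_mem_Icc _ p).1)
    (fun e => mul_le_of_le_one_right (hpos e).le (cutFun_mem_Icc _ p).2) hsum.summable

theorem sum_le_position (hpos : ∀ e, 0 < w e) (hsum : HasSum w 1) {p : G.Point} (F : Finset A)
    (hF : ∀ e ∈ F, cutFun (X e) p = 1) : ∑ e ∈ F, w e ≤ position X w p := by
  rw [Finset.sum_congr rfl fun e he => show w e = w e * cutFun (X e) p by rw [hF e he, mul_one]]
  exact (summable_position hpos hsum p).sum_le_tsum F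
    fun e _ => mul_nonneg (hpos e).le (cutFun_mem_Icc _ p).1

theorem position_add_sum_le (hpos : ∀ e, 0 < w e) (hsum : HasSum w 1) {p : G.Point}
    (F : Finset A) (hF : ∀ e ∈ F, cutFun (X e) p = 0) :
    position X w p + ∑ e ∈ F, w e ≤ 1 := by
  have h1 : HasSum (fun e : A => w e - w e * cutFun (X e) p) (1 - position X w p) :=
    hsum.sub (summable_position hpos hsum p).hasSum
  have h2 := sum_le_hasSum F (fun e _ => sub_nonneg.2
    (mul_le_of_le_one_right (hpos e).le (cutFun_mem_Icc (X e) p).2)) h1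
  have h3 : ∑ e ∈ F, w e = ∑ e ∈ F, (w e - w e * cutFun (X e) p) :=
    Finset.sum_congr rfl fun e he => by rw [hF e he, mul_zero, sub_zero]
  linarith

theorem position_mem_Icc (hpos : ∀ e, 0 < w e) (hsum : HasSum w 1) (p : G.Point) :
    position X w p ∈ Set.Icc (0 : ℝ) 1 := by
  constructor
  · simpa using sum_le_position hpos hsum (X := X) (p := p) ∅ (by simp)
  · simpa using position_add_sum_le hpos hsum (X := X) (p := p) ∅ (by simp)

theorem position_sub_eq (hpos : ∀ e, 0 < w e) (hsum : HasSum w 1) {p q : G.Point} (e : A)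
    (h : ∀ g : A, g ≠ e → cutFun (X g) q = cutFun (X g) p) :
    position X w q - position X w p = w e * (cutFun (X e) q - cutFun (X e) p) := by
  rw [position, position, ← (summable_position hpos hsum q).tsum_sub
    (summable_position hpos hsum p), tsum_eq_single e fun g hg => by rw [h g hg, sub_self]]
  ring

end

namespace IsTightFamily

variable {X : E → Set V} {w : A → ℝ}

theorem continuous_position (hX : G.IsTightFamily s t A X) (hpos : ∀ e, 0 < w e)
    (hsum : HasSum w 1) : Continuous (position X w : G.Point → ℝ) := by
  refine continuous_tsum (u := w)
    (fun e => continuous_const.mul (continuous_cutFun (hX.splits e e.2).finite)) hsum.summable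
    fun e p => ?_
  rw [Real.norm_of_nonneg (mul_nonneg (hpos e).le (cutFun_mem_Icc _ p).1)]
  exact mul_le_of_le_one_right (hpos e).le (cutFun_mem_Icc _ p).2

theorem position_source (hX : G.IsTightFamily s t A X) (hs : s ∈ G.verticesAndEnds) :
    position X w s = 0 := by
  simp [position, fun e : A => cutFun_eq_zero hs (hX.splits e e.2).source]

theorem position_target (hX : G.IsTightFamily s t A X) (ht : t ∈ G.verticesAndEnds)
    (hsum : HasSum w 1) : position X w t = 1 := by
  simp [position, fun e : A => cutFun_eq_one ht (hX.splits e e.2).target, hsum.tsum_eq]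

theorem position_inner (hX : G.IsTightFamily s t A X) (hpos : ∀ e, 0 < w e)
    (hsum : HasSum w 1) (e : A) (x : Set.Ioo (0 : ℝ) 1) :
    position X w (.inner e x : G.Point) =
      position X w (.vertex (G.tail e) : G.Point) + w e * x := by
  have h := position_sub_eq hpos hsum (X := X) (p := (.vertex (G.tail e) : G.Point))
    (q := .inner e x) e fun g hg => cutFun_inner_of_iff
      (hX.mem_iff g g.2 e e.2 fun h => hg (Subtype.ext h.symm)) x
  rw [cutFun_inner_of_forward (hX.tail_mem e e.2) (hX.head_notMem e e.2)] at h
  have h0 : cutFun (X e) (.vertex (G.tail e) : G.Point) = 0 := by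
    simp [cutFun, hX.tail_mem e e.2]
  rw [h0, sub_zero] at h
  linarith

theorem position_head (hX : G.IsTightFamily s t A X) (hpos : ∀ e, 0 < w e)
    (hsum : HasSum w 1) (e : A) :
    position X w (.vertex (G.head e) : G.Point) =
      position X w (.vertex (G.tail e) : G.Point) + w e := by
  have h := position_sub_eq hpos hsum (X := X) (p := (.vertex (G.tail e) : G.Point))
    (q := .vertex (G.head e)) e fun g hg => by
      have := hX.mem_iff g g.2 e e.2 fun h => hg (Subtype.ext h.symm)
      by_cases ht : G.tail e ∈ X g
      · simp [cutFun, ht, this.1 ht]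
      · have hh : G.head e ∉ X g := fun h => ht (this.2 h)
        simp [cutFun, ht, hh]
  have h0 : cutFun (X e) (.vertex (G.tail e) : G.Point) = 0 := by
    simp [cutFun, hX.tail_mem e e.2]
  have h1 : cutFun (X e) (.vertex (G.head e) : G.Point) = 1 := by
    simp [cutFun, hX.head_notMem e e.2]
  rw [h0, h1] at h
  linarith

/-- If one coordinate increases strictly, then no other decreases: those of earlier edges are 1 at
`q`, those of later edges are 0 at `p`. Hence `position` determines every coordinate. -/
theorem position_lt_position (hX : G.IsTightFamily s t A X) (hpos : ∀ e, 0 < w e)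
    (hsum : HasSum w 1) {p q : G.Point} (hp : p ∈ G.edgeClosure A) (hq : q ∈ G.edgeClosure A)
    {e : E} (he : e ∈ A) (h : cutFun (X e) p < cutFun (X e) q) :
    position X w p < position X w q := by
  refine Summable.tsum_lt_tsum (i := ⟨e, he⟩) (fun g => ?_)
    (mul_lt_mul_of_pos_left h (hpos _)) (summable_position hpos hsum p)
    (summable_position hpos hsum q)
  refine mul_le_mul_of_nonneg_left ?_ (hpos g).le
  by_cases hge : (g : E) = e
  · rw [hge]
    exact h.le
  by_cases hmem : G.tail g ∈ X e
  · rcases hX.cutFun_eq_zero_or_eq_one g.2 he hge hmem hq with h' | h'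
    · exact absurd (h'.symm.trans_gt h) (cutFun_mem_Icc _ p).1.not_gt
    · rw [h']
      exact (cutFun_mem_Icc _ p).2
  · have hmem' := (hX.tail_mem_iff he g.2 (Ne.symm hge)).2 hmem
    rcases hX.cutFun_eq_zero_or_eq_one he g.2 (Ne.symm hge) hmem' hp with h' | h'
    · rw [h']
      exact (cutFun_mem_Icc _ q).1
    · exact absurd (h'.symm.trans_lt h) (cutFun_mem_Icc _ q).2.not_gt

theorem cutFun_eq_of_position_eq (hX : G.IsTightFamily s t A X) (hpos : ∀ e, 0 < w e)
    (hsum : HasSum w 1) {p q : G.Point} (hp : p ∈ G.edgeClosure A) (hq : q ∈ G.edgeClosure A)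
    (h : position X w p = position X w q) {e : E} (he : e ∈ A) :
    cutFun (X e) p = cutFun (X e) q :=
  le_antisymm (not_lt.1 fun hlt => (hX.position_lt_position hpos hsum hq hp he hlt).ne' h)
    (not_lt.1 fun hlt => (hX.position_lt_position hpos hsum hp hq he hlt).ne h)

theorem mem_nearby_iff_of_cutFun_eq {Y : Set V} {p q : G.Point} (hp : p ∈ G.verticesAndEnds)
    (hq : q ∈ G.verticesAndEnds) (h : cutFun Y p = cutFun Y q) :
    Y ∈ nearby p ↔ Y ∈ nearby q := by
  rw [cutFun_eq_ite Y hp, cutFun_eq_ite Y hq] at h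
  split_ifs at h with h1 h2 h2 <;> simp_all

theorem eq_inner_of_cutFun_eq (hX : G.IsTightFamily s t A X) {e : E} (he : e ∈ A)
    {x : Set.Ioo (0 : ℝ) 1} {q : G.Point} (hq : q ∈ G.edgeClosure A)
    (h : cutFun (X e) (.inner e x : G.Point) = cutFun (X e) q) : q = .inner e x := by
  rw [cutFun_inner_of_forward (hX.tail_mem e he) (hX.head_notMem e he)] at h
  have hne : ∀ {q' : G.Point}, q' ∈ G.verticesAndEnds → cutFun (X e) q' ≠ x := by
    intro q' hq' heq
    rw [cutFun_eq_ite _ hq'] at heq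
    split_ifs at heq
    exacts [x.2.1.ne heq, x.2.2.ne' heq]
  rcases mem_verticesAndEnds_or_inner q with hqV | ⟨g, y, rfl⟩
  · exact absurd h.symm (hne hqV)
  · have hg := inner_mem_edgeClosure.1 hq
    by_cases hge : g = e
    · subst hge
      rw [cutFun_inner_of_forward (hX.tail_mem g he) (hX.head_notMem g he)] at h
      rw [Subtype.ext h]
    · rw [cutFun_inner_of_iff (hX.mem_iff e he g hg hge)] at h
      exact absurd h.symm (hne (Or.inl ⟨_, rfl⟩))

theorem injOn_position (hX : G.IsTightFamily s t A X) (hlf : G.LocallyFinite)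
    (hpos : ∀ e, 0 < w e) (hsum : HasSum w 1) :
    Set.InjOn (position X w) (G.edgeClosure A) := by
  intro p hp q hq h
  have hcut := fun e (he : e ∈ A) => hX.cutFun_eq_of_position_eq hpos hsum hp hq h he
  rcases mem_verticesAndEnds_or_inner p with hpV | ⟨e, x, rfl⟩
  · rcases mem_verticesAndEnds_or_inner q with hqV | ⟨e, x, rfl⟩
    · exact hX.eq_of_forall_mem_nearby_iff hlf hpV hqV (Or.inl hp) (Or.inl hq)
        fun e he => mem_nearby_iff_of_cutFun_eq hpV hqV (hcut e he)
    · have he := inner_mem_edgeClosure.1 hq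
      exact hX.eq_inner_of_cutFun_eq he hp (hcut e he).symm
  · have he := inner_mem_edgeClosure.1 hp
    exact (hX.eq_inner_of_cutFun_eq he hq (hcut e he)).symm

end IsTightFamily

end Position

end DirMultigraph

namespace DirMultigraph

/-! ### Surjectivity, the arc, and the converse direction -/

section Arcs

variable {V E : Type*} {G : DirMultigraph V E} {s t : G.Point} {A : Set E}

namespace IsTightFamily

variable {X : E → Set V} {w : A → ℝ}

theorem head_notMem_of_position_le (hX : G.IsTightFamily s t A X) (hpos : ∀ e, 0 < w e)
    (hsum : HasSum w 1) {e g : A} (h : position X w (.vertex (G.head g) : G.Point) ≤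
      position X w (.vertex (G.head e) : G.Point)) : G.head e ∉ X g := by
  intro hmem
  refine h.not_gt (hX.position_lt_position hpos hsum (e := g)
    (subset_closure ⟨e, e.2, Or.inr rfl⟩) (subset_closure ⟨g, g.2, Or.inr rfl⟩) g.2 ?_)
  simp [cutFun, hmem, hX.head_notMem g g.2]

theorem tail_mem_of_position_le (hX : G.IsTightFamily s t A X) (hpos : ∀ e, 0 < w e)
    (hsum : HasSum w 1) {e g : A} (h : position X w (.vertex (G.tail e) : G.Point) ≤
      position X w (.vertex (G.tail g) : G.Point)) : G.tail e ∈ X g := by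
  by_contra hmem
  refine h.not_gt (hX.position_lt_position hpos hsum (e := g)
    (subset_closure ⟨g, g.2, Or.inl rfl⟩) (subset_closure ⟨e, e.2, Or.inl rfl⟩) g.2 ?_)
  simp [cutFun, hmem, hX.tail_mem g g.2]

theorem exists_position_eq (hX : G.IsTightFamily s t A X) [CompactSpace G.Point]
    (hpos : ∀ e, 0 < w e) (hsum : HasSum w 1) {c : ℝ} (hc : c ∈ Set.Icc (0 : ℝ) 1) :
    ∃ p ∈ G.edgeClosure A, position X w p = c := by
  have hclosed : IsClosed (position X w '' G.edgeClosure A) :=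
    ((isClosed_closure.isCompact).image (hX.continuous_position hpos hsum)).isClosed
  by_contra hnot
  obtain ⟨ε, hε, hball⟩ := Metric.isOpen_iff.1 hclosed.isOpen_compl c hnot
  have hgap : ∀ p ∈ G.edgeClosure A, ε ≤ |position X w p - c| := fun p hp => by
    by_contra hlt
    exact hball (not_le.1 hlt) ⟨p, hp, rfl⟩
  have htail : ∀ e : A, Point.vertex (G.tail e) ∈ G.edgeClosure A :=
    fun e => subset_closure ⟨e, e.2, Or.inl rfl⟩
  have hhead : ∀ e : A, Point.vertex (G.head e) ∈ G.edgeClosure A :=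
    fun e => subset_closure ⟨e, e.2, Or.inr rfl⟩
  -- No edge of `A` bridges the gap around `c`, since one of its inner points would then have
  -- position `c`.
  have hsides : ∀ e : A, position X w (.vertex (G.head e) : G.Point) ≤ c - ε ∨
      c + ε ≤ position X w (.vertex (G.tail e) : G.Point) := by
    intro e
    by_contra! hcon
    have h1 : c < position X w (.vertex (G.head e) : G.Point) := by
      by_contra! hle
      have := hgap _ (hhead e)
      rw [abs_of_nonpos (by linarith)] at this
      linarith [hcon.1]
    have h2 : position X w (.vertex (G.tail e) : G.Point) < c := by
      by_contra! hle
      have := hgap _ (htail e)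
      rw [abs_of_nonneg (by linarith)] at this
      linarith [hcon.2]
    rw [hX.position_head hpos hsum] at h1
    refine hnot ⟨.inner e ⟨(c - position X w (.vertex (G.tail e) : G.Point)) / w e,
      div_pos (by linarith) (hpos e), (div_lt_one (hpos e)).2 (by linarith)⟩,
      inner_mem_edgeClosure.2 e.2, ?_⟩
    rw [hX.position_inner hpos hsum, mul_div_cancel₀ _ (hpos e).ne']
    ring
  -- Finitely many edges carry almost all the weight, but those before the gap weigh at most `c - ε`
  -- and those after it at most `1 - c - ε`, or 0 if there are none. The cap 1/2 covers the case in
  -- which both bounds are 0.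
  obtain ⟨F, hF⟩ := (hsum.eventually (lt_mem_nhds
    (show 1 - min ε (1 / 2) < 1 by linarith [lt_min hε one_half_pos]))).exists
  have hm1 := min_le_left ε (1 / 2)
  have hm2 := min_le_right ε (1 / 2)
  classical
  rw [← Finset.sum_filter_add_sum_filter_not F
    fun e : A => position X w (.vertex (G.head e) : G.Point) ≤ c - ε] at hF
  set F₁ := F.filter fun e : A => position X w (.vertex (G.head e) : G.Point) ≤ c - ε with hF₁
  set F₂ := F.filter fun e : A => ¬position X w (.vertex (G.head e) : G.Point) ≤ c - ε with hF₂
  have hsum₁ : ∑ e ∈ F₁, w e ≤ max 0 (c - ε) := by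
    rcases F₁.eq_empty_or_nonempty with h | h
    · simp [h]
    obtain ⟨e, he, hmax⟩ := F₁.exists_max_image
      (fun e : A => position X w (.vertex (G.head e) : G.Point)) h
    refine (sum_le_position hpos hsum F₁ fun g hg => ?_).trans
      ((Finset.mem_filter.1 he).2.trans (le_max_right _ _))
    simp [cutFun, hX.head_notMem_of_position_le hpos hsum (hmax g hg)]
  have hsum₂ : ∑ e ∈ F₂, w e ≤ max 0 (1 - c - ε) := by
    rcases F₂.eq_empty_or_nonempty with h | h
    · simp [h]
    obtain ⟨e, he, hmin⟩ := F₂.exists_min_image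
      (fun e : A => position X w (.vertex (G.tail e) : G.Point)) h
    have h1 := position_add_sum_le hpos hsum (X := X) (p := (.vertex (G.tail e) : G.Point)) F₂
      fun g hg => by
        simp [cutFun, hX.tail_mem_of_position_le hpos hsum (hmin g hg)]
    have h2 := (hsides e).resolve_left (Finset.mem_filter.1 he).2
    exact le_max_of_le_right (by linarith)
  rcases max_choice 0 (c - ε) with h1 | h1 <;> rcases max_choice 0 (1 - c - ε) with h2 | h2 <;>
    rw [h1] at hsum₁ <;> rw [h2] at hsum₂ <;> linarith [hc.1, hc.2]

theorem mem_edgeClosure_of_cutFun_eq (hX : G.IsTightFamily s t A X) (hlf : G.LocallyFinite)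
    {p q : G.Point} (hp : p ∈ G.edgeClosure A)
    (hqV : q ∈ G.verticesAndEnds) (hq : q = s ∨ q = t)
    (h : ∀ e ∈ A, cutFun (X e) p = cutFun (X e) q) : q ∈ G.edgeClosure A := by
  rcases mem_verticesAndEnds_or_inner p with hpV | ⟨e, x, rfl⟩
  · exact hX.eq_of_forall_mem_nearby_iff hlf hpV hqV (Or.inl hp) (Or.inr hq)
      (fun e he => mem_nearby_iff_of_cutFun_eq hpV hqV (h e he)) ▸ hp
  · have he := inner_mem_edgeClosure.1 hp
    have h' := h e he
    rw [cutFun_inner_of_forward (hX.tail_mem e he) (hX.head_notMem e he),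
      cutFun_eq_ite _ hqV] at h'
    split_ifs at h'
    exacts [absurd h' x.2.1.ne', absurd h' x.2.2.ne]

theorem source_mem_edgeClosure (hX : G.IsTightFamily s t A X) (hlf : G.LocallyFinite)
    [CompactSpace G.Point] (hs : s ∈ G.verticesAndEnds) (hpos : ∀ e, 0 < w e)
    (hsum : HasSum w 1) : s ∈ G.edgeClosure A := by
  -- The point at position 0 has all coordinates 0, as `s` does, and therefore equals `s`.
  obtain ⟨p, hp, hp0⟩ := hX.exists_position_eq hpos hsum (c := 0) (by simp)
  refine hX.mem_edgeClosure_of_cutFun_eq hlf hp hs (Or.inl rfl) fun e he => ?_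
  have h2 : w ⟨e, he⟩ * cutFun (X e) p ≤ position X w p :=
    (summable_position hpos hsum p).le_tsum ⟨e, he⟩
      fun g _ => mul_nonneg (hpos g).le (cutFun_mem_Icc _ p).1
  rw [hp0] at h2
  rw [cutFun_eq_zero hs (hX.splits e he).source]
  exact le_antisymm (nonpos_of_mul_nonpos_right h2 (hpos _)) (cutFun_mem_Icc _ p).1

theorem target_mem_edgeClosure (hX : G.IsTightFamily s t A X) (hlf : G.LocallyFinite)
    [CompactSpace G.Point] (ht : t ∈ G.verticesAndEnds) (hpos : ∀ e, 0 < w e)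
    (hsum : HasSum w 1) : t ∈ G.edgeClosure A := by
  obtain ⟨p, hp, hp1⟩ := hX.exists_position_eq hpos hsum (c := 1) (by simp)
  refine hX.mem_edgeClosure_of_cutFun_eq hlf hp ht (Or.inr rfl) fun e he => ?_
  have h1 : HasSum (fun e : A => w e - w e * cutFun (X e) p) (1 - position X w p) :=
    hsum.sub (summable_position hpos hsum p).hasSum
  have h2 : w ⟨e, he⟩ - w ⟨e, he⟩ * cutFun (X e) p ≤ 1 - position X w p :=
    le_hasSum h1 ⟨e, he⟩ fun g _ =>
      sub_nonneg.2 (mul_le_of_le_one_right (hpos g).le (cutFun_mem_Icc _ p).2)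
  rw [hp1, sub_self, ← mul_one_sub] at h2
  rw [cutFun_eq_one ht (hX.splits e he).target]
  linarith [nonpos_of_mul_nonpos_right h2 (hpos _), (cutFun_mem_Icc (X e) p).2]

theorem isDirectedArc (hX : G.IsTightFamily s t A X) (hlf : G.LocallyFinite)
    (hconn : G.WeaklyConnected) (hs : s ∈ G.verticesAndEnds) (ht : t ∈ G.verticesAndEnds)
    (hpos : ∀ e, 0 < w e) (hsum : HasSum w 1) : G.IsDirectedArc s t (G.edgeClosure A) := by
  have := compactSpace_point hlf hconn
  have : CompactSpace (G.edgeClosure A) := isCompact_iff_compactSpace.1 isClosed_closure.isCompact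
  let f : G.edgeClosure A → unitInterval :=
    fun p => ⟨position X w (p : G.Point), position_mem_Icc hpos hsum _⟩
  have hf : Function.Bijective f := by
    refine ⟨fun p q h => Subtype.ext (hX.injOn_position hlf hpos hsum p.2 q.2
      (congrArg Subtype.val h)), fun c => ?_⟩
    obtain ⟨p, hp, hpc⟩ := hX.exists_position_eq hpos hsum c.2
    exact ⟨⟨p, hp⟩, Subtype.ext hpc⟩
  have hcont : Continuous (Equiv.ofBijective f hf) :=
    ((hX.continuous_position hpos hsum).comp continuous_subtype_val).subtype_mk _
  let φ : G.edgeClosure A ≃ₜ unitInterval := hcont.homeoOfEquivCompactToT2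
  have hφ : ∀ p, (φ p : ℝ) = position X w (p : G.Point) := fun _ => rfl
  have hσ : ∀ u (p : G.Point) (hp : p ∈ G.edgeClosure A),
      (φ.symm u : G.Point) = p ↔ u = φ ⟨p, hp⟩ := by
    intro u p hp
    rw [← φ.symm_apply_eq, Subtype.ext_iff]
  refine ⟨fun u => φ.symm u, Topology.IsEmbedding.subtypeVal.comp φ.symm.isEmbedding,
    ?_, ?_, ?_, ?_⟩
  · exact (φ.symm.surjective.range_comp _).trans Subtype.range_coe
  · rw [hσ 0 s (hX.source_mem_edgeClosure hlf hs hpos hsum)]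
    exact Subtype.ext (hX.position_source hs).symm
  · rw [hσ 1 t (hX.target_mem_edgeClosure hlf ht hpos hsum)]
    exact Subtype.ext (hX.position_target ht hsum).symm
  · intro e x y hx hy
    have he := inner_mem_edgeClosure.1 hx
    have hlt : φ ⟨_, hx⟩ < φ ⟨_, hy⟩ ↔ x < y := by
      rw [← Subtype.coe_lt_coe, hφ, hφ]
      change position X w (.inner e x : G.Point) < position X w (.inner e y : G.Point) ↔ _
      rw [hX.position_inner hpos hsum ⟨e, he⟩, hX.position_inner hpos hsum ⟨e, he⟩,
        add_lt_add_iff_left, mul_lt_mul_iff_right₀ (hpos _), Subtype.coe_lt_coe]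
    rw [← hlt]
    constructor
    · rintro ⟨u, v, hu, hv, huv⟩
      rwa [(hσ u _ hx).1 hu, (hσ v _ hy).1 hv] at huv
    · exact fun h => ⟨_, _, (hσ _ _ hx).2 rfl, (hσ _ _ hy).2 rfl, h⟩

end IsTightFamily

theorem exists_weights {ι : Type*} [Countable ι] [Nonempty ι] :
    ∃ w : ι → ℝ, (∀ i, 0 < w i) ∧ HasSum w 1 := by
  have := Encodable.ofCountable ι
  obtain ⟨w, hpos, c, hc, -⟩ := posSumOfEncodable one_pos ι
  obtain ⟨i⟩ := ‹Nonempty ι›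
  have hc0 : 0 < c := (hpos i).trans_le (le_hasSum hc i fun j _ => (hpos j).le)
  exact ⟨fun i => w i / c, fun i => div_pos (hpos i) hc0, by simpa [hc0.ne'] using hc.div_const c⟩

theorem isDirectedArc_of_minimal (hlf : G.LocallyFinite) (hconn : G.WeaklyConnected)
    (hs : s ∈ G.verticesAndEnds) (ht : t ∈ G.verticesAndEnds) (hst : s ≠ t)
    (hA : Minimal (G.MeetsCuts s t) A) : G.IsDirectedArc s t (G.edgeClosure A) := by
  obtain ⟨X, hX⟩ := exists_isTightFamily hs ht hA
  have := countable_edges hlf hconn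
  obtain ⟨Y, hY, hsY, htY⟩ := hlf.exists_separating hs ht hst
  obtain ⟨e, he, -⟩ := hX.meets Y ⟨hY, hsY, htY⟩
  have : Nonempty A := ⟨⟨e, he⟩⟩
  obtain ⟨w, hpos, hsum⟩ := exists_weights (ι := A)
  exact hX.isDirectedArc hlf hconn hs ht hpos hsum

theorem IsDirectedArc.meetsCuts (hs : s ∈ G.verticesAndEnds) (ht : t ∈ G.verticesAndEnds)
    (h : G.IsDirectedArc s t (G.edgeClosure A)) : G.MeetsCuts s t A := by
  refine (meetsCuts_iff hs ht).2 fun X hX => ?_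
  obtain ⟨σ, hσ, hrange, hσ0, hσ1, hdir⟩ := h
  have hcont : Continuous fun u => cutFun X (σ u) :=
    (continuous_cutFun hX.finite).comp hσ.continuous
  have h0 : cutFun X (σ 0) = 0 := by rw [hσ0, cutFun_eq_zero hs hX.source]
  have h1 : cutFun X (σ 1) = 1 := by rw [hσ1, cutFun_eq_one ht hX.target]
  -- At the last time `u` with value at most 1/2 the value is exactly 1/2, which occurs only inside
  -- a crossing edge.
  obtain ⟨u, hu, hmax⟩ := ((isClosed_Iic (a := (1 / 2 : ℝ))).preimage hcont).isCompact
    |>.exists_isGreatest ⟨0, by simp [h0]⟩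
  have hhalf : cutFun X (σ u) = 1 / 2 := by
    obtain ⟨v, hv, hv'⟩ := intermediate_value_Icc (unitInterval.le_one' (t := u))
      hcont.continuousOn ⟨hu, by rw [h1]; norm_num⟩
    have hvu : v ≤ u := hmax hv'.le
    rwa [le_antisymm hvu hv.1] at hv'
  have hmem : σ u ∈ G.edgeClosure A := hrange ▸ Set.mem_range_self u
  rcases mem_verticesAndEnds_or_inner (σ u) with hV | ⟨e, x, hex⟩
  · rw [cutFun_eq_ite _ hV] at hhalf
    split_ifs at hhalf <;> norm_num at hhalf
  rw [hex] at hmem hhalf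
  have he := inner_mem_edgeClosure.1 hmem
  refine ⟨e, he, ?_⟩
  by_contra hnot
  by_cases hiff : G.tail e ∈ X ↔ G.head e ∈ X
  · rw [cutFun_inner_of_iff hiff, cutFun_eq_ite _ (Or.inl ⟨_, rfl⟩)] at hhalf
    split_ifs at hhalf <;> norm_num at hhalf
  have htail : G.tail e ∉ X := by tauto
  have hhead : G.head e ∈ X := by tauto
  rw [cutFun_inner_of_backward htail hhead] at hhalf
  -- On an edge entering `X`, any point past the midpoint has value below 1/2, and the arc reaches
  -- it after `u`.
  let y : Set.Ioo (0 : ℝ) 1 := ⟨3 / 4, by norm_num, by norm_num⟩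
  have hxy : x < y := Subtype.coe_lt_coe.1 (show (x : ℝ) < 3 / 4 by linarith)
  obtain ⟨u', v, hu', hv, hlt⟩ := (hdir e x y hmem (inner_mem_edgeClosure.2 he)).2 hxy
  obtain rfl : u' = u := hσ.injective (hu'.trans hex.symm)
  refine hlt.not_ge (hmax ?_)
  change cutFun X (σ v) ≤ 1 / 2
  rw [hv, cutFun_inner_of_backward htail hhead]
  change 1 - (3 / 4 : ℝ) ≤ 1 / 2
  norm_num

/-- An `s`–`t` arc contains no other `s`–`t` arc. -/
theorem IsDirectedArc.eq_of_subset {W W' : Set G.Point} (h : G.IsDirectedArc s t W)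
    (h' : G.IsDirectedArc s t W') (hsub : W' ⊆ W) : W' = W := by
  obtain ⟨σ, hσ, rfl, hσ0, hσ1, -⟩ := h
  obtain ⟨σ', hσ', rfl, hσ0', hσ1', -⟩ := h'
  refine hsub.antisymm ?_
  -- The map `ρ` is `σ'` followed by the inverse of `σ`: a path in `[0, 1]` from 0 to 1, hence onto.
  choose ρ hρ using fun u => hsub (Set.mem_range_self u)
  have hcont : Continuous ρ := by
    rw [hσ.continuous_iff]
    exact hσ'.continuous.congr fun u => (hρ u).symm
  have hρ0 : ρ 0 = 0 := hσ.injective (by rw [hρ, hσ0, hσ0'])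
  have hρ1 : ρ 1 = 1 := hσ.injective (by rw [hρ, hσ1, hσ1'])
  rintro _ ⟨u, rfl⟩
  obtain ⟨v, -, hv⟩ := intermediate_value_Icc (unitInterval.le_one' (t := 0)) hcont.continuousOn
    (show u ∈ Set.Icc (ρ 0) (ρ 1) by rw [hρ0, hρ1]; exact ⟨u.2.1, u.2.2⟩)
  exact ⟨v, by rw [← hρ, hv]⟩

theorem IsDirectedArc.minimal (hlf : G.LocallyFinite) (hconn : G.WeaklyConnected)
    (hs : s ∈ G.verticesAndEnds) (ht : t ∈ G.verticesAndEnds) (hst : s ≠ t)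
    (h : G.IsDirectedArc s t (G.edgeClosure A)) : Minimal (G.MeetsCuts s t) A := by
  refine ⟨h.meetsCuts hs ht, fun B hB hBA e he => ?_⟩
  obtain ⟨C, hCB, hC⟩ := MeetsCuts.exists_minimal hB
  have harc := isDirectedArc_of_minimal hlf hconn hs ht hst hC
  have hsub : G.edgeClosure C ⊆ G.edgeClosure A := by
    refine closure_mono ?_
    rintro (a | ω | ⟨g, x⟩) hz
    · obtain ⟨g, hg, hga⟩ := hz
      exact ⟨g, hBA (hCB hg), hga⟩
    · exact hz
    · exact hBA (hCB hz)
  refine hCB ((inner_mem_edgeClosure (G := G) (x := ⟨1 / 2, by norm_num, by norm_num⟩)).1 ?_)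
  rw [h.eq_of_subset harc hsub]
  exact inner_mem_edgeClosure.2 he

end Arcs

end DirMultigraph

theorem lemma3p2 {V E : Type*} (G : DirMultigraph V E) (hlf : G.LocallyFinite)
    (hconn : G.WeaklyConnected) (s t : G.Point) (hs : s ∈ G.verticesAndEnds)
    (ht : t ∈ G.verticesAndEnds) (hst : s ≠ t) (A : Set E) :
    List.TFAE [
      G.IsDirectedArc s t (G.edgeClosure A),
      Minimal (G.MeetsCuts s t) A,
      Minimal (G.BalancedOnCuts s t) A] := by
  tfae_have 1 → 2 := fun h => h.minimal hlf hconn hs ht hst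
  tfae_have 2 → 1 := fun h => DirMultigraph.isDirectedArc_of_minimal hlf hconn hs ht hst h
  tfae_have 2 → 3 := fun h => ⟨DirMultigraph.balancedOnCuts_of_minimal hs ht h,
    fun B hB hBA => h.2 hB.meetsCuts hBA⟩
  tfae_have 3 → 2 := fun h => by
    obtain ⟨B, hBA, hB⟩ := h.1.meetsCuts.exists_minimal
    have hAB := h.2 (DirMultigraph.balancedOnCuts_of_minimal hs ht hB) hBA
    rwa [Set.Subset.antisymm hAB hBA]
  tfae_finish
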